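/- **Setting.** Let $\mathcal U$ be a separable real Hilbert space and $\mathcal C_0$ a symmetric, positive definite, trace class operator on $\mathcal U$ with eigensystem $(\lambda_k,e_k)$. For $t\ge 0$ let $\mathcal U^t=\mathcal D(\mathcal C_0^{-t/2})$ with $\|u\|_{\mathcal U^t}=\|\mathcal C_0^{-t/2}u\|_{\mathcal U}$. Let $s_0=\inf\{\sigma\ge 0:\operatorname{Tr}(\mathcal C_0^\sigma)<\infty\}$, let $\tilde s\in(s_0,1]$, and let $\mathbb P_0=\mathcal N(0,\mathcal C_0)$. Let $\mathcal X$ be a metric space, $\mathcal G$ a forward operator on $\mathcal U$, and $\mathcal L_x$ $(x\in\mathcal X)$ measurement operators such that $\mathcal L_x\mathcal G(u)$ lies in a separable Hilbert space $\mathcal H$. Let $\beta>0$ and $m\ge 1$. With $\mathcal Y$ the data space, a dataset is $S=((x_j,y_j))_{j=1}^m\in(\mathcal X\times\mathcal Y)^m$. The data-dependent prior is $\mathbb P_S^\theta=\mathcal N(f(S;\theta),\mathcal C_0)$, where $f(S;\theta)\in\mathcal U^{1+\tilde s}$ and $S\mapsto f(S;\theta)\in\mathcal U^{1+\tilde s}$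 is continuous, for the given $\theta\in\Theta$. For a potential $\Phi$ set $$Z_m=\int_{\mathcal U}\exp\Big(-\frac\beta m\sum_{j=1}^m\Phi(u;x_j,y_j)\Big)\,\mathbb P_S^\theta(du),\qquad \frac{d\mathbb Q(S,\mathbb P_S^\theta)}{d\mathbb P_S^\theta}(u)=\frac1{Z_m}\exp\Big(-\frac\beta m\sum_{j=1}^m\Phi(u;x_j,y_j)\Big).$$ Let $\Gamma$ be a bounded, symmetric, positive definite operator on $\mathcal H$ (the noise covariance). Consider one of the following two cases. **(a) Data in a Hilbert scale.** Let $\mathcal C_1$ be a symmetric, positive definite, trace class operator on $\mathcal H$. For real $t$ let $\mathcal H^t$ be the Hilbert scale generated by it, with $\|v\|_{\mathcal H^t}=\|\mathcal C_1^{-t/2}v\|_{\mathcal H}$, completed if $t<0$. Let $s_1=\inf\{\sigma\ge0:\operatorname{Tr}(\mathcal C_1^\sigma)<\infty\}$, let $s\in(s_1,1]$ and $\alpha\in\mathbb R$. Let $\mathcal C_1^{s/2}\Gamma^{-1/2}$ extend to a bounded operator $T:\mathcal H^{\alpha-s}\to\mathcal H$. Put $\mathcal Y=\mathcal H^{\alpha-s}$,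 $A=\mathcal C_1^{-s/2}\Gamma^{-1/2}$ and $$\Phi(u;x,y)=\tfrac12\|\Gamma^{-1/2}\mathcal L_x\mathcal G(u)\|_{\mathcal H}^2-\langle\Gamma^{-1/2}y,\Gamma^{-1/2}\mathcal L_x\mathcal G(u)\rangle_{\mathcal H},$$ where the last pairing means $\langle Ty,\,A\mathcal L_x\mathcal G(u)\rangle_{\mathcal H}$. Assume that $\mathcal L_x\mathcal G(u)$ lies in the domain of $A$ for $u\in\mathcal U^{1-\tilde s}$, $x\in\mathcal X$. **(b) Finite-dimensional data.** Let $\mathcal Y=\mathcal H=\mathbb R^{N_d}$ and $A=\mathrm{Id}$. Let $\Phi$ be given by the same formula, $\Phi(u;x,y)=\frac12\|\Gamma^{-1/2}\mathcal L_x\mathcal G(u)\|^2-\langle\Gamma^{-1/2}y,\Gamma^{-1/2}\mathcal L_x\mathcal G(u)\rangle$, or by $\Phi(u;x,y)=\frac12\|\Gamma^{-1/2}(y-\mathcal L_x\mathcal G(u))\|^2$. In both cases assume that for all $x,x'\in\mathcal X$ and $u,u_1,u_2\in\mathcal U^{1-\tilde s}$ $$\|A\mathcal L_x\mathcal G(u)\|_{\mathcal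 H}\le M_1(\|u\|_{\mathcal U^{1-\tilde s}}),$$ $$\|A(\mathcal L_x\mathcal G(u_1)-\mathcal L_x\mathcal G(u_2))\|_{\mathcal H}\le M_2(\|u_1\|_{\mathcal U^{1-\tilde s}},\|u_2\|_{\mathcal U^{1-\tilde s}})\|u_1-u_2\|_{\mathcal U^{1-\tilde s}},$$ $$\lim_{x\to x'}\|A(\mathcal L_x\mathcal G(u)-\mathcal L_{x'}\mathcal G(u))\|_{\mathcal H}=0,$$ with $M_1,M_2:[0,\infty)\to[0,\infty)$, resp. $[0,\infty)^2\to[0,\infty)$, non-decreasing in each argument. In case (a) assume further that $M_1$ grows at most linearly, or that $\exp(\delta M_1(\|u\|_{\mathcal U^{1-\tilde s}})^2)$ is $\mathbb P_0$-integrable for some $\delta>0$. **Theorem 3.3 (Bayesian well-posedness of inverse problems).** In each case, for every dataset $S$ the density above is $\mathbb P^\theta_S$-a.e. measurable and $0<Z_m<\infty$, so that Bayes' formula defines a probability measure $\mathbb Q(S,\mathbb P_S^\theta)$. Moreover the posterior is continuous in the Hellinger distance with respect to the data: for every $S'=((x'_j,y'_j))_{j=1}^m$, $$d_{\mathrm{Hell}}\big(\mathbb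 Q(S,\mathbb P_S^\theta),\mathbb Q(S',\mathbb P_{S'}^\theta)\big)\to0\quad\text{as }x_j\to x_j'\text{ in }\mathcal X\text{ and }y_j\to y_j'\text{ in }\mathcal Y\ (j=1,\dots,m).$$ -/

import Mathlib

open MeasureTheory ProbabilityTheory Filter Topology
open scoped NNReal ENNReal RealInnerProductSpace

noncomputable section

/-! ### Fractional powers and Hilbert scales of a diagonal operator -/

section Spectral

variable {ι E : Type*} [NormedAddCommGroup E] [InnerProductSpace ℝ E]

/-- `C` is a symmetric, positive definite, trace class operator with eigensystem `(lam k, e k)`,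
the eigenvectors `e k` forming a Hilbert basis: `C = ∑ lam k (e k ⊗ e k)`, `lam k > 0`,
`Tr C = ∑ lam k < ∞`. -/
structure IsTraceClassEigensystem (C : E →L[ℝ] E) (e : HilbertBasis ι ℝ E) (lam : ι → ℝ) :
    Prop where
  pos : ∀ k, 0 < lam k
  apply_basis : ∀ k, C (e k) = lam k • e k
  trace : Summable lam

/-- The infimum of the exponents `σ ≥ 0` with `Tr (C ^ σ) = ∑ lam k ^ σ < ∞`. -/
def traceExponent (lam : ι → ℝ) : ℝ :=
  sInf {σ : ℝ | 0 ≤ σ ∧ Summable fun k => lam k ^ σ}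

/-- `v` lies in the domain of `C ^ r`, for `C = ∑ lam k (e k ⊗ e k)` and `r` real. -/
def InPowDomain (e : HilbertBasis ι ℝ E) (lam : ι → ℝ) (r : ℝ) (v : E) : Prop :=
  Summable fun k => (lam k ^ r * ⟪e k, v⟫) ^ 2

/-- `C ^ r v = ∑ lam k ^ r ⟪e k, v⟫ e k`, meaningful for `v` in the domain of `C ^ r`. -/
def powOp (e : HilbertBasis ι ℝ E) (lam : ι → ℝ) (r : ℝ) (v : E) : E :=
  ∑' k, (lam k ^ r * ⟪e k, v⟫) • e k

/-- For `t ≥ 0`, membership in the Hilbert scale space `E ^ t = D(C ^ (-t/2)) ⊆ E`. -/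
def InScale (e : HilbertBasis ι ℝ E) (lam : ι → ℝ) (t : ℝ) (v : E) : Prop :=
  InPowDomain e lam (-t / 2) v

/-- The norm `‖C ^ (-t/2) v‖` of the Hilbert scale space `E ^ t`, for `v ∈ E ^ t`. -/
def scaleNorm (e : HilbertBasis ι ℝ E) (lam : ι → ℝ) (t : ℝ) (v : E) : ℝ≥0 :=
  ‖powOp e lam (-t / 2) v‖₊

/-- The underlying vector space of the Hilbert scale space of real order `t`: families of
coefficients `c` with `∑ (lam k ^ (-t/2) * c k) ^ 2 < ∞`. -/
def scaleSubmodule (lam : ι → ℝ) (t : ℝ) : Submodule ℝ (ι → ℝ) where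
  carrier := {c | Memℓp (fun k => lam k ^ (-t / 2) * c k) 2}
  add_mem' {a b} ha hb := by
    have h := Memℓp.add ha hb
    have h2 : (fun k => lam k ^ (-t / 2) * (a + b) k) =
        (fun k => lam k ^ (-t / 2) * a k) + fun k => lam k ^ (-t / 2) * b k := by
      funext k; simp [mul_add]
    simpa only [Set.mem_ofPred_eq, h2] using h
  zero_mem' := by
    have h : (fun k => lam k ^ (-t / 2) * (0 : ι → ℝ) k) = 0 := by funext k; simp
    simpa only [Set.mem_ofPred_eq, h] using zero_memℓp
  smul_mem' r a ha := by
    have h := Memℓp.const_smul ha r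
    have h2 : (fun k => lam k ^ (-t / 2) * (r • a) k) =
        r • fun k => lam k ^ (-t / 2) * a k := by
      funext k; simp [mul_left_comm]
    simpa only [Set.mem_ofPred_eq, h2] using h

/-- The Hilbert scale space of arbitrary real order `t` generated by an operator with eigensystem
`(lam k, e k)`, i.e. the completion of the finite linear combinations of the `e k` under
`‖v‖ = ‖C ^ (-t/2) v‖`. An element is given by its family of coefficients with respect to the
`e k`; for `t < 0` it need not be a vector of the original space. -/
def HilbertScale (lam : ι → ℝ) (t : ℝ) : Type _ := scaleSubmodule lam t

namespace HilbertScale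

variable {lam : ι → ℝ} {t : ℝ}

instance : AddCommGroup (HilbertScale lam t) :=
  inferInstanceAs (AddCommGroup (scaleSubmodule lam t))

instance : Module ℝ (HilbertScale lam t) :=
  inferInstanceAs (Module ℝ (scaleSubmodule lam t))

/-- The coefficient of index `k`. -/
def coeff (y : HilbertScale lam t) (k : ι) : ℝ := (y : scaleSubmodule lam t).1 k

/-- The isometry `y ↦ C ^ (-t/2) y` onto square summable sequences. -/
def toL2 (lam : ι → ℝ) (t : ℝ) : HilbertScale lam t →ₗ[ℝ] lp (fun _ : ι => ℝ) 2 where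
  toFun y := ⟨fun k => lam k ^ (-t / 2) * coeff y k, (y : scaleSubmodule lam t).2⟩
  map_add' a b := by
    ext k
    change lam k ^ (-t / 2) * (coeff a k + coeff b k) =
      lam k ^ (-t / 2) * coeff a k + lam k ^ (-t / 2) * coeff b k
    ring
  map_smul' r a := by
    ext k
    change lam k ^ (-t / 2) * (r * coeff a k) = r * (lam k ^ (-t / 2) * coeff a k)
    ring

instance : SeminormedAddCommGroup (HilbertScale lam t) :=
  SeminormedAddCommGroup.induced _ _ (toL2 lam t)

instance : NormedSpace ℝ (HilbertScale lam t) :=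
  NormedSpace.induced ℝ _ _ (toL2 lam t)

end HilbertScale

/-- `R` is the square root `Γ ^ (1/2)` of the symmetric, positive definite bounded operator `Γ`. -/
structure IsPosDefSqrt (Γ R : E →L[ℝ] E) : Prop where
  pos : Γ.IsPositive
  injective : Function.Injective Γ
  sqrt_pos : R.IsPositive
  sqrt_sq : R ∘L R = Γ

/-- `R⁻¹ v`, for an injective operator `R` and `v` in its range. -/
def opInv (R : E →L[ℝ] E) (v : E) : E := Function.invFun R v

/-- `C ^ (-s/2) Γ ^ (-1/2) v`, where `R = Γ ^ (1/2)` and `C` has eigensystem `(zeta k, φ k)`. -/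
def whiten (R : E →L[ℝ] E) (φ : HilbertBasis ι ℝ E) (zeta : ι → ℝ) (s : ℝ) (v : E) : E :=
  powOp φ zeta (-s / 2) (opInv R v)

/-- `v` lies in the domain of `C ^ (-s/2) Γ ^ (-1/2)`. -/
def InWhitenDomain (R : E →L[ℝ] E) (φ : HilbertBasis ι ℝ E) (zeta : ι → ℝ) (s : ℝ) (v : E) :
    Prop :=
  v ∈ Set.range R ∧ InPowDomain φ zeta (-s / 2) (opInv R v)

/-- The bounded operator `T` on the Hilbert scale space of order `a` extends
`C ^ (s/2) Γ ^ (-1/2)`: if `y` is (the coefficient family of) the vector `Γ ^ (1/2) h`, then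
`T y = C ^ (s/2) h`. -/
def IsWhitenedDataOp (R : E →L[ℝ] E) (φ : HilbertBasis ι ℝ E) (zeta : ι → ℝ) (s : ℝ) {a : ℝ}
    (T : HilbertScale zeta a →L[ℝ] E) : Prop :=
  ∀ (y : HilbertScale zeta a) (h : E),
    (∀ k, y.coeff k = ⟪φ k, R h⟫) → T y = powOp φ zeta (s / 2) h

end Spectral

/-! ### Gaussian measures, Bayes' formula and the Hellinger distance -/

section Bayes

/-- `μ` is the Gaussian measure `𝒩(a, C)` with mean `a` and covariance operator `C`. -/
structure IsGaussianWith {E : Type*} [NormedAddCommGroup E] [InnerProductSpace ℝ E]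
    [CompleteSpace E] [MeasurableSpace E] [BorelSpace E] (μ : Measure E) (a : E)
    (C : E →L[ℝ] E) : Prop where
  isGaussian : IsGaussian μ
  mean : ∫ u, u ∂μ = a
  cov : ∀ v w, covarianceBilin μ v w = ⟪C v, w⟫

/-- The Hellinger distance `(½ ∫ (√(dμ/dρ) - √(dν/dρ))² dρ)^(1/2)` of two probability measures,
computed with the common dominating measure `ρ = μ + ν` (its value does not depend on `ρ`). -/
def hellingerDist {E : Type*} [MeasurableSpace E] (μ ν : Measure E) : ℝ :=
  √((1 / 2) * ∫ u, (√(μ.rnDeriv (μ + ν) u).toReal - √(ν.rnDeriv (μ + ν) u).toReal) ^ 2 ∂(μ + ν))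

variable {U X Y : Type*} [MeasurableSpace U] {m : ℕ}

/-- The unnormalized density `exp(-(β/m) ∑ⱼ Φ(u; xⱼ, yⱼ))` of the base posterior. -/
def likelihood (β : ℝ) (Φ : U → X → Y → ℝ) (S : Fin m → X × Y) (u : U) : ℝ≥0∞ :=
  ENNReal.ofReal (Real.exp (-(β / m) * ∑ j, Φ u (S j).1 (S j).2))

/-- The normalizing constant `Z_m`, the integral of the likelihood against the prior `P`. -/
def normalizingConstant (β : ℝ) (Φ : U → X → Y → ℝ) (S : Fin m → X × Y) (P : Measure U) : ℝ≥0∞ :=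
  ∫⁻ u, likelihood β Φ S u ∂P

/-- The base posterior `ℚ(S, P)`, with `dℚ/dP = Z_m⁻¹ exp(-(β/m) ∑ⱼ Φ(u; xⱼ, yⱼ))`. -/
def basePosterior (β : ℝ) (Φ : U → X → Y → ℝ) (S : Fin m → X × Y) (P : Measure U) : Measure U :=
  P.withDensity fun u => (normalizingConstant β Φ S P)⁻¹ * likelihood β Φ S u

/-- Bayesian well-posedness for the data-dependent prior `S ↦ P S`: for every dataset, Bayes'
formula has a measurable density and `0 < Z_m < ∞`, so that the base posterior is a probability
measure; and the base posterior is continuous in Hellinger distance with respect to the data. -/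
def BayesWellPosed [TopologicalSpace X] [TopologicalSpace Y] (β : ℝ) (Φ : U → X → Y → ℝ)
    (P : (Fin m → X × Y) → Measure U) : Prop :=
  (∀ S, AEMeasurable (likelihood β Φ S) (P S) ∧
    0 < normalizingConstant β Φ S (P S) ∧ normalizingConstant β Φ S (P S) < ∞ ∧
    IsProbabilityMeasure (basePosterior β Φ S (P S))) ∧
  ∀ S₀, Tendsto
    (fun S => hellingerDist (basePosterior β Φ S (P S)) (basePosterior β Φ S₀ (P S₀)))
    (𝓝 S₀) (𝓝 0)

end Bayes

/-! ### Assumptions on the prior mean and on the forward operator -/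

section Assumptions

variable {ι U : Type*} [NormedAddCommGroup U] [InnerProductSpace ℝ U]

/-- The prior is `P S = 𝒩(f S, C₀)`, where `S ↦ f S` is a continuous map from the space of
datasets to the Hilbert scale space `U ^ (1 + st)`. -/
structure IsDataDependentPrior [CompleteSpace U] [MeasurableSpace U] [BorelSpace U]
    {D : Type*} [TopologicalSpace D] (C₀ : U →L[ℝ] U) (e : HilbertBasis ι ℝ U) (lam : ι → ℝ)
    (st : ℝ) (f : D → U) (P : D → Measure U) : Prop where
  gaussian : ∀ S, IsGaussianWith (P S) (f S) C₀
  mem_scale : ∀ S, InScale e lam (1 + st) (f S)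
  continuous : ∀ S₀, Tendsto (fun S => scaleNorm e lam (1 + st) (f S - f S₀)) (𝓝 S₀) (𝓝 0)

/-- Bounds for the forward maps `F x = 𝓛_x ∘ 𝓖` on `U ^ t`, measured through `A` (which stands for
`C₁ ^ (-s/2) Γ ^ (-1/2)` or for the identity): growth controlled by the non-decreasing `M₁`, local
Lipschitz continuity with constant `M₂` non-decreasing in each argument, and continuity in `x`. -/
structure ForwardBounds {H X : Type*} [NormedAddCommGroup H] [TopologicalSpace X]
    (e : HilbertBasis ι ℝ U) (lam : ι → ℝ) (t : ℝ) (A : H → H) (F : X → U → H)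
    (M₁ : ℝ≥0 → ℝ≥0) (M₂ : ℝ≥0 → ℝ≥0 → ℝ≥0) : Prop where
  mono₁ : Monotone M₁
  mono₂_left : ∀ b, Monotone fun a => M₂ a b
  mono₂_right : ∀ a, Monotone (M₂ a)
  bound : ∀ x u, InScale e lam t u → ‖A (F x u)‖₊ ≤ M₁ (scaleNorm e lam t u)
  lipschitz : ∀ x u v, InScale e lam t u → InScale e lam t v →
    ‖A (F x u - F x v)‖₊ ≤
      M₂ (scaleNorm e lam t u) (scaleNorm e lam t v) * scaleNorm e lam t (u - v)
  continuous : ∀ u, InScale e lam t u → ∀ x₀,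
    Tendsto (fun x => ‖A (F x u - F x₀ u)‖) (𝓝 x₀) (𝓝 0)

end Assumptions

/-! ### Potentials -/

section Potentials

variable {ι H U X : Type*} [NormedAddCommGroup H] [InnerProductSpace ℝ H]

/-- The potential `½ ‖Γ^(-1/2) F x u‖² - ⟪Γ^(-1/2) y, Γ^(-1/2) F x u⟫` for data `y` in the Hilbert
scale space of order `a`. The pairing is
`⟪C₁^(s/2) Γ^(-1/2) y, C₁^(-s/2) Γ^(-1/2) F x u⟫`, with `T` extending `C₁^(s/2) Γ^(-1/2)`. -/
def scalePotential (R : H →L[ℝ] H) (φ : HilbertBasis ι ℝ H) (zeta : ι → ℝ) (s : ℝ) {a : ℝ}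
    (T : HilbertScale zeta a →L[ℝ] H) (F : X → U → H) (u : U) (x : X)
    (y : HilbertScale zeta a) : ℝ :=
  (1 / 2) * ‖opInv R (F x u)‖ ^ 2 - ⟪T y, whiten R φ zeta s (F x u)⟫

/-- The potential `½ ‖Γ^(-1/2) F x u‖² - ⟪Γ^(-1/2) y, Γ^(-1/2) F x u⟫` for finite-dimensional
data. -/
def finPotential (R : H →L[ℝ] H) (F : X → U → H) (u : U) (x : X) (y : H) : ℝ :=
  (1 / 2) * ‖opInv R (F x u)‖ ^ 2 - ⟪opInv R y, opInv R (F x u)⟫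

/-- The least squares potential `½ ‖Γ^(-1/2) (y - F x u)‖²` for finite-dimensional data. -/
def misfitPotential (R : H →L[ℝ] H) (F : X → U → H) (u : U) (x : X) (y : H) : ℝ :=
  (1 / 2) * ‖opInv R (y - F x u)‖ ^ 2

end Potentials

end

/-! Everything is transferred to the fixed centered prior 𝒩(0, C₀), so that only densities depend on
the data. Put p = -(1-s̃)/2 and q = -(1+s̃)/2, so that p + q = -1. Since C₀^(1+2p) = C₀^s̃ is trace
class, the centered prior is carried by U^(1-s̃), the domain of C₀^p. With g = C₀^q f(S), the
shifted prior has density exp(⟪g, C₀^p u⟫ - ‖C₀^(s̃/2) g‖²/2) (`IsGaussianWith.eq_withDensity`).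
Because f(S) lies in U^(1+s̃), g is a vector of U and the formal pairing of C₀⁻¹ f(S) with u is a
genuine inner product. So the density is continuous in S for every u in U^(1-s̃), and for S near S₀
it is at most exp(c ‖C₀^p u‖), which is integrable by Fernique's theorem.

The potential is continuous in the data and bounded below by -b(y) N(u), where N has all exponential
moments. For data in a scale, the pairing is at most ‖T y‖ M₁(‖u‖); in finite dimension, completing
the square leaves -½ ‖Γ^(-1/2) y‖², whatever the growth of M₁. Dominated convergence then gives
convergence of the normalizing constants and L¹ convergence of the posterior densities
(`bayesWellPosed_of_dominated`), and the L¹ distance controls the squared Hellinger distance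
(`hellingerDist_le`). -/

/-! ### Calculus of fractional powers of a diagonal operator. -/

section SpectralCalculus

variable {ι E : Type*} [NormedAddCommGroup E] [InnerProductSpace ℝ E]

theorem HilbertBasis.ext_inner (e : HilbertBasis ι ℝ E) {v w : E}
    (h : ∀ k, ⟪e k, v⟫ = ⟪e k, w⟫) : v = w := by
  apply e.repr.injective
  ext k
  simpa only [e.repr_apply_apply] using h k

theorem HilbertBasis.hasSum_inner_sq (e : HilbertBasis ι ℝ E) (v : E) :
    HasSum (fun k => ⟪e k, v⟫ ^ 2) (‖v‖ ^ 2) := by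
  have h := e.hasSum_inner_mul_inner v v
  rw [real_inner_self_eq_norm_sq] at h
  refine h.congr_fun fun k => ?_
  rw [real_inner_comm, sq]

variable {e : HilbertBasis ι ℝ E} {lam : ι → ℝ}

theorem InPowDomain.memℓp {r : ℝ} {v : E} (h : InPowDomain e lam r v) :
    Memℓp (fun k => lam k ^ r * ⟪e k, v⟫) 2 := by
  refine memℓp_gen ?_
  simpa [InPowDomain, -norm_mul, -abs_mul] using h

theorem InPowDomain.powOp_eq {r : ℝ} {v : E} (h : InPowDomain e lam r v) :
    powOp e lam r v = e.repr.symm ⟨fun k => lam k ^ r * ⟪e k, v⟫, h.memℓp⟩ :=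
  (e.hasSum_repr_symm ⟨fun k => lam k ^ r * ⟪e k, v⟫, h.memℓp⟩).tsum_eq

theorem InPowDomain.hasSum_powOp {r : ℝ} {v : E} (h : InPowDomain e lam r v) :
    HasSum (fun k => (lam k ^ r * ⟪e k, v⟫) • e k) (powOp e lam r v) := by
  rw [h.powOp_eq]
  exact e.hasSum_repr_symm ⟨fun k => lam k ^ r * ⟪e k, v⟫, h.memℓp⟩

theorem InPowDomain.inner_powOp {r : ℝ} {v : E} (h : InPowDomain e lam r v) (k : ι) :
    ⟪e k, powOp e lam r v⟫ = lam k ^ r * ⟪e k, v⟫ := by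
  rw [h.powOp_eq, ← e.repr_apply_apply, LinearIsometryEquiv.apply_symm_apply]

theorem InPowDomain.add {r : ℝ} {v w : E} (hv : InPowDomain e lam r v)
    (hw : InPowDomain e lam r w) : InPowDomain e lam r (v + w) := by
  have h := (hv.memℓp.add hw.memℓp).summable (by norm_num)
  refine h.congr fun k => ?_
  simp [inner_add_right, mul_add]

theorem InPowDomain.smul {r : ℝ} {v : E} (c : ℝ) (hv : InPowDomain e lam r v) :
    InPowDomain e lam r (c • v) := by
  refine (Summable.mul_left (c ^ 2) hv).congr fun k => ?_
  rw [inner_smul_right]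
  ring

theorem InPowDomain.sub {r : ℝ} {v w : E} (hv : InPowDomain e lam r v)
    (hw : InPowDomain e lam r w) : InPowDomain e lam r (v - w) := by
  have h := hv.add (hw.smul (-1))
  rwa [neg_one_smul, ← sub_eq_add_neg] at h

theorem InPowDomain.powOp_add {r : ℝ} {v w : E} (hv : InPowDomain e lam r v)
    (hw : InPowDomain e lam r w) :
    powOp e lam r (v + w) = powOp e lam r v + powOp e lam r w := by
  refine e.ext_inner fun k => ?_
  rw [(hv.add hw).inner_powOp, inner_add_right, inner_add_right, hv.inner_powOp, hw.inner_powOp,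
    mul_add]

theorem InPowDomain.powOp_smul {r : ℝ} {v : E} (c : ℝ) (hv : InPowDomain e lam r v) :
    powOp e lam r (c • v) = c • powOp e lam r v := by
  refine e.ext_inner fun k => ?_
  rw [(hv.smul c).inner_powOp, inner_smul_right, inner_smul_right, hv.inner_powOp]
  ring

theorem InPowDomain.powOp_sub {r : ℝ} {v w : E} (hv : InPowDomain e lam r v)
    (hw : InPowDomain e lam r w) :
    powOp e lam r (v - w) = powOp e lam r v - powOp e lam r w := by
  refine e.ext_inner fun k => ?_
  rw [(hv.sub hw).inner_powOp, inner_sub_right, inner_sub_right, hv.inner_powOp, hw.inner_powOp,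
    mul_sub]

theorem InPowDomain.norm_powOp_sq {r : ℝ} {v : E} (h : InPowDomain e lam r v) :
    ‖powOp e lam r v‖ ^ 2 = ∑' k, (lam k ^ r * ⟪e k, v⟫) ^ 2 := by
  rw [← (e.hasSum_inner_sq _).tsum_eq]
  simp_rw [h.inner_powOp]

theorem inPowDomain_powOp_iff (hpos : ∀ k, 0 < lam k) {a b : ℝ} {v : E}
    (hb : InPowDomain e lam b v) :
    InPowDomain e lam a (powOp e lam b v) ↔ InPowDomain e lam (a + b) v := by
  refine summable_congr fun k => ?_
  rw [hb.inner_powOp, Real.rpow_add (hpos k), mul_assoc]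

theorem InPowDomain.powOp_powOp (hpos : ∀ k, 0 < lam k) {a b : ℝ} {v : E}
    (hb : InPowDomain e lam b v) (hab : InPowDomain e lam (a + b) v) :
    powOp e lam a (powOp e lam b v) = powOp e lam (a + b) v := by
  refine e.ext_inner fun k => ?_
  rw [((inPowDomain_powOp_iff hpos hb).2 hab).inner_powOp, hb.inner_powOp, hab.inner_powOp,
    Real.rpow_add (hpos k), mul_assoc]

theorem inPowDomain_zero (v : E) : InPowDomain e lam 0 v := by
  simpa [InPowDomain] using (e.hasSum_inner_sq v).summable

theorem powOp_zero_exponent (v : E) : powOp e lam 0 v = v := by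
  refine e.ext_inner fun k => ?_
  rw [(inPowDomain_zero v).inner_powOp, Real.rpow_zero, one_mul]

/-- Operators of complementary orders are adjoint to each other. -/
theorem InPowDomain.inner_powOp_powOp (hpos : ∀ k, 0 < lam k) {a b c d : ℝ} {v w : E}
    (hv : InPowDomain e lam a v) (hw : InPowDomain e lam b w)
    (hv' : InPowDomain e lam c v) (hw' : InPowDomain e lam d w) (h : a + b = c + d) :
    ⟪powOp e lam a v, powOp e lam b w⟫ = ⟪powOp e lam c v, powOp e lam d w⟫ := by
  rw [← e.tsum_inner_mul_inner, ← e.tsum_inner_mul_inner]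
  refine tsum_congr fun k => ?_
  rw [real_inner_comm, real_inner_comm (e k), hv.inner_powOp, hw.inner_powOp, hv'.inner_powOp,
    hw'.inner_powOp]
  have h1 : lam k ^ a * lam k ^ b = lam k ^ c * lam k ^ d := by
    rw [← Real.rpow_add (hpos k), ← Real.rpow_add (hpos k), h]
  linear_combination ⟪e k, v⟫ * ⟪e k, w⟫ * h1

theorem inPowDomain_of_nonneg (hpos : ∀ k, 0 < lam k) {K : ℝ} (hK : ∀ k, lam k ≤ K) {r : ℝ}
    (hr : 0 ≤ r) (v : E) : InPowDomain e lam r v := by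
  refine Summable.of_nonneg_of_le (fun k => sq_nonneg _) (fun k => ?_)
    ((e.hasSum_inner_sq v).summable.mul_left ((K ^ r) ^ 2))
  rw [mul_pow]
  have := Real.rpow_nonneg (hpos k).le r
  gcongr
  · exact (hpos k).le
  · exact hK k

theorem norm_powOp_le (hpos : ∀ k, 0 < lam k) {K : ℝ} (hK : ∀ k, lam k ≤ K) {r : ℝ}
    (hr : 0 ≤ r) (v : E) : ‖powOp e lam r v‖ ≤ |K ^ r| * ‖v‖ := by
  refine abs_le_of_sq_le_sq' ?_ (by positivity) |>.2
  have hd := inPowDomain_of_nonneg (e := e) hpos hK hr v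
  rw [hd.norm_powOp_sq, mul_pow, sq_abs, ← (e.hasSum_inner_sq v).tsum_eq, ← tsum_mul_left]
  refine Summable.tsum_le_tsum (fun k => ?_) hd ((e.hasSum_inner_sq v).summable.mul_left _)
  rw [mul_pow]
  have := Real.rpow_nonneg (hpos k).le r
  gcongr
  · exact (hpos k).le
  · exact hK k

theorem exists_powOp_eq_continuousLinearMap (e : HilbertBasis ι ℝ E) (hpos : ∀ k, 0 < lam k)
    {K : ℝ} (hK : ∀ k, lam k ≤ K) {r : ℝ} (hr : 0 ≤ r) :
    ∃ J : E →L[ℝ] E, ∀ v, J v = powOp e lam r v := by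
  have hd := inPowDomain_of_nonneg (e := e) hpos hK hr
  let J : E →ₗ[ℝ] E :=
    { toFun := powOp e lam r
      map_add' := fun v w => (hd v).powOp_add (hd w)
      map_smul' := fun c v => (hd v).powOp_smul c }
  exact ⟨J.mkContinuous (|K ^ r|) (norm_powOp_le hpos hK hr), fun v => rfl⟩

theorem traceExponent_nonneg (lam : ι → ℝ) : 0 ≤ traceExponent lam :=
  Real.sInf_nonneg fun _ h => h.1

/-- Some σ < s is summable by definition of the infimum, and boundedness of the eigenvalues gives
lam k ^ s ≤ K ^ (s - σ) * lam k ^ σ. -/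
theorem summable_rpow_of_traceExponent_lt (hpos : ∀ k, 0 < lam k) (hs : Summable lam) {s : ℝ}
    (h : traceExponent lam < s) : Summable fun k => lam k ^ s := by
  have hK : ∀ k, lam k ≤ ∑' j, lam j := fun k => hs.le_tsum k fun j _ => (hpos j).le
  have hne : {σ : ℝ | 0 ≤ σ ∧ Summable fun k => lam k ^ σ}.Nonempty :=
    ⟨1, zero_le_one, by simpa using hs⟩
  obtain ⟨σ, ⟨-, hσ⟩, hlt⟩ := exists_lt_of_csInf_lt hne h
  refine Summable.of_nonneg_of_le (fun k => (Real.rpow_pos_of_pos (hpos k) _).le) (fun k => ?_)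
    (hσ.mul_left ((∑' j, lam j) ^ (s - σ)))
  have h0 : lam k ^ s = lam k ^ (s - σ) * lam k ^ σ := by
    rw [← Real.rpow_add (hpos k), sub_add_cancel]
  rw [h0]
  have h1 := (Real.rpow_pos_of_pos (hpos k) σ).le
  gcongr
  · exact (hpos k).le
  · exact hK k

theorem IsTraceClassEigensystem.exists_bound {C : E →L[ℝ] E}
    (hC : IsTraceClassEigensystem C e lam) : ∃ K, ∀ k, lam k ≤ K :=
  ⟨∑' k, lam k, fun k => hC.trace.le_tsum k fun j _ => (hC.pos j).le⟩

theorem IsTraceClassEigensystem.countable {C : E →L[ℝ] E}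
    (hC : IsTraceClassEigensystem C e lam) : Countable ι := by
  have h := hC.trace.countable_support
  exact Set.countable_univ_iff.1 (h.mono fun k _ => (hC.pos k).ne')

theorem IsTraceClassEigensystem.apply_eq {C : E →L[ℝ] E}
    (hC : IsTraceClassEigensystem C e lam) (v : E) : C v = powOp e lam 1 v := by
  obtain ⟨K, hK⟩ := hC.exists_bound
  have h := (e.hasSum_repr v).mapL C
  refine h.unique ((inPowDomain_of_nonneg hC.pos hK zero_le_one v).hasSum_powOp.congr_fun ?_)
  intro k
  rw [map_smul, hC.apply_basis, e.repr_apply_apply, smul_smul, Real.rpow_one, mul_comm]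

end SpectralCalculus

/-- Young's inequality, used to turn one Gaussian-type exponential moment into all linear
exponential moments. -/
theorem Real.mul_le_sq_div_add_mul_sq {δ : ℝ} (hδ : 0 < δ) (c x : ℝ) :
    c * x ≤ c ^ 2 / (4 * δ) + δ * x ^ 2 := by
  have h : 0 ≤ (c / (2 * δ) - x) ^ 2 * δ := by positivity
  have h' : (c / (2 * δ) - x) ^ 2 * δ = c ^ 2 / (4 * δ) + δ * x ^ 2 - c * x := by
    field_simp
    ring
  linarith

/-! ### Gaussian measures on the Hilbert scale and the Cameron–Martin formula. -/

section GaussianScale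

variable {ι U : Type*} [NormedAddCommGroup U] [InnerProductSpace ℝ U] [CompleteSpace U]
  [SecondCountableTopology U] [MeasurableSpace U] [BorelSpace U]
  {C₀ : U →L[ℝ] U} {e : HilbertBasis ι ℝ U} {lam : ι → ℝ}

theorem IsGaussianWith.charFun_eq {P : Measure U} {h : U} {C : U →L[ℝ] U}
    (hP : IsGaussianWith P h C) (v : U) :
    charFun P v = Complex.exp (⟪v, h⟫ * Complex.I - ⟪C v, v⟫ / 2) := by
  have := hP.isGaussian
  rw [IsGaussian.charFun_eq', hP.cov]
  simp only [id, hP.mean]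

theorem IsGaussianWith.integral_inner_sq {P : Measure U} {C : U →L[ℝ] U}
    (hP : IsGaussianWith P 0 C) (v : U) : ∫ u, ⟪v, u⟫ ^ 2 ∂P = ⟪C v, v⟫ := by
  have := hP.isGaussian
  rw [← hP.cov, covarianceBilin_apply IsGaussian.memLp_two_id]
  simp [hP.mean, sq]

theorem IsGaussianWith.integrable_inner_sq {P : Measure U} {h : U} {C : U →L[ℝ] U}
    (hP : IsGaussianWith P h C) (v : U) : Integrable (fun u => ⟪v, u⟫ ^ 2) P := by
  have := hP.isGaussian
  exact ((IsGaussian.memLp_two_id (μ := P)).const_inner v).integrable_sq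

/-- A centered Gaussian measure is carried by the domain of `C₀ ^ p` if `C₀ ^ (1 + 2 p)` is trace
class. -/
theorem IsGaussianWith.ae_inPowDomain (hC₀ : IsTraceClassEigensystem C₀ e lam) {P : Measure U}
    (hP : IsGaussianWith P 0 C₀) {p : ℝ} (hp : Summable fun k => lam k ^ (1 + 2 * p)) :
    ∀ᵐ u ∂P, InPowDomain e lam p u := by
  have := hC₀.countable
  -- The expectation of ‖C₀^p u‖² is ∑ lam k ^ (2p) * lam k, the trace of C₀^(1+2p); a finite
  -- expectation forces almost sure finiteness.
  have hint : ∫⁻ u, ∑' k, ENNReal.ofReal ((lam k ^ p * ⟪e k, u⟫) ^ 2) ∂P ≠ ∞ := by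
    rw [lintegral_tsum fun k => by fun_prop]
    have h : ∀ k, ∫⁻ u, ENNReal.ofReal ((lam k ^ p * ⟪e k, u⟫) ^ 2) ∂P =
        ENNReal.ofReal (lam k ^ (1 + 2 * p)) := fun k => by
      simp_rw [mul_pow]
      rw [← ofReal_integral_eq_lintegral_ofReal ((hP.integrable_inner_sq _).const_mul _)
        (ae_of_all _ fun u => by positivity), integral_const_mul, hP.integral_inner_sq,
        hC₀.apply_basis, real_inner_smul_left, real_inner_self_eq_norm_sq,
        e.orthonormal.norm_eq_one, Real.rpow_add (hC₀.pos k), Real.rpow_one, mul_comm 2 p,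
        Real.rpow_mul (hC₀.pos k).le, Real.rpow_two]
      ring_nf
    simp_rw [h]
    exact hp.tsum_ofReal_ne_top
  filter_upwards [ae_lt_top' (by fun_prop) hint] with u hu
  refine (ENNReal.summable_toReal hu.ne).congr fun k => ?_
  rw [ENNReal.toReal_ofReal (sq_nonneg _)]

omit [CompleteSpace U] in
theorem aemeasurable_powOp [Countable ι] {μ : Measure U} {p : ℝ}
    (h : ∀ᵐ u ∂μ, InPowDomain e lam p u) : AEMeasurable (powOp e lam p) μ := by
  refine aemeasurable_of_tendsto_metrizable_ae (atTop : Filter (Finset ι))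
    (f := fun s u => ∑ k ∈ s, (lam k ^ p * ⟪e k, u⟫) • e k) (fun s => by fun_prop) ?_
  filter_upwards [h] with u hu
  exact hu.hasSum_powOp

/-- The characteristic function of the image of `𝒩(0, C₀)` under `C₀ ^ p`, for negative `p`. -/
theorem IsGaussianWith.charFun_map_powOp (hC₀ : IsTraceClassEigensystem C₀ e lam) {P : Measure U}
    (hP : IsGaussianWith P 0 C₀) {p r : ℝ} (hp : Summable fun k => lam k ^ (1 + 2 * p))
    (hr : 0 ≤ r) (hrp : 2 * r = 1 + 2 * p) (g : U) :
    charFun (P.map (powOp e lam p)) g = Complex.exp (-(‖powOp e lam r g‖ ^ 2 : ℝ) / 2) := by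
  have := hC₀.countable
  have := hP.isGaussian
  obtain ⟨K, hK⟩ := hC₀.exists_bound
  have hdom := hP.ae_inPowDomain hC₀ hp
  -- Finite truncations of C₀^p g: the vector g itself need not lie in the domain of C₀^p. Pairing
  -- them with u gives ⟪g, C₀^p u⟫ in the limit, while their variances increase to ‖C₀^r g‖², since
  -- r = p + 1/2.
  let G : Finset ι → U := fun s => ∑ k ∈ s, (lam k ^ p * ⟪e k, g⟫) • e k
  have hG : ∀ s u, ⟪G s, u⟫ = ⟪g, ∑ k ∈ s, (lam k ^ p * ⟪e k, u⟫) • e k⟫ := fun s u => by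
    simp only [G, sum_inner, inner_sum, real_inner_smul_left, real_inner_smul_right,
      real_inner_comm g]
    exact Finset.sum_congr rfl fun k _ => by ring
  have hcov : ∀ s, ⟪C₀ (G s), G s⟫ = ∑ k ∈ s, (lam k ^ r * ⟪e k, g⟫) ^ 2 := fun s => by
    have h1 : C₀ (G s) = ∑ k ∈ s, (lam k * (lam k ^ p * ⟪e k, g⟫)) • e k := by
      simp only [G, map_sum, map_smul, hC₀.apply_basis, smul_smul]
      exact Finset.sum_congr rfl fun k _ => by rw [mul_comm]
    rw [h1, e.orthonormal.inner_sum]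
    refine Finset.sum_congr rfl fun k _ => ?_
    have h2 : lam k * lam k ^ p * lam k ^ p = lam k ^ r * lam k ^ r := by
      rw [← Real.rpow_add (hC₀.pos k), ← two_mul r, hrp, Real.rpow_add (hC₀.pos k), Real.rpow_one,
        two_mul p, Real.rpow_add (hC₀.pos k), mul_assoc]
    simp only [conj_trivial]
    linear_combination ⟪e k, g⟫ ^ 2 * h2
  have hlim₁ : Tendsto (fun s => charFun P (G s)) atTop
      (𝓝 (charFun (P.map (powOp e lam p)) g)) := by
    simp only [charFun_apply]
    rw [integral_map (aemeasurable_powOp hdom) (by fun_prop)]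
    refine tendsto_integral_filter_of_dominated_convergence (fun _ => 1)
      (.of_forall fun s => by fun_prop)
      (.of_forall fun s => ae_of_all _ fun u => (Complex.norm_exp_ofReal_mul_I _).le)
      (integrable_const _) ?_
    filter_upwards [hdom] with u hu
    refine (Complex.continuous_exp.tendsto _).comp (Tendsto.mul_const _ ?_)
    refine (Complex.continuous_ofReal.tendsto _).comp ?_
    simp_rw [real_inner_comm _ u, hG, real_inner_comm g]
    exact (Filter.Tendsto.inner tendsto_const_nhds hu.hasSum_powOp)
  have hlim₂ : Tendsto (fun s => charFun P (G s)) atTop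
      (𝓝 (Complex.exp (-(‖powOp e lam r g‖ ^ 2 : ℝ) / 2))) := by
    have hd := inPowDomain_of_nonneg (e := e) hC₀.pos hK hr g
    have h1 : ∀ s, charFun P (G s) =
        Complex.exp (-((∑ k ∈ s, (lam k ^ r * ⟪e k, g⟫) ^ 2 : ℝ) : ℂ) / 2) := fun s => by
      rw [hP.charFun_eq, ← hcov]
      simp [neg_div]
    simp_rw [h1, hd.norm_powOp_sq]
    refine (Complex.continuous_exp.tendsto _).comp (Tendsto.div_const (Tendsto.neg ?_) _)
    exact (Complex.continuous_ofReal.tendsto _).comp hd.hasSum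
  exact tendsto_nhds_unique hlim₁ hlim₂

/-- For negative p the map is unbounded and meaningful only almost everywhere, so Gaussianity is
read off from the characteristic function, whose covariance form is ⟪C₀^r x, C₀^r y⟫. -/
theorem IsGaussianWith.isGaussian_map_powOp (hC₀ : IsTraceClassEigensystem C₀ e lam)
    {P : Measure U} (hP : IsGaussianWith P 0 C₀) {p r : ℝ}
    (hp : Summable fun k => lam k ^ (1 + 2 * p)) (hr : 0 ≤ r) (hrp : 2 * r = 1 + 2 * p) :
    IsGaussian (P.map (powOp e lam p)) := by
  have := hC₀.countable
  have := hP.isGaussian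
  obtain ⟨K, hK⟩ := hC₀.exists_bound
  obtain ⟨J, hJ⟩ := exists_powOp_eq_continuousLinearMap e hC₀.pos hK hr
  rw [isGaussian_iff_gaussian_charFun]
  refine ⟨0, (innerSL ℝ).bilinearComp J J, ⟨⟨fun x y => ?_⟩, ⟨fun x => ?_⟩⟩, fun v => ?_⟩
  · simp [real_inner_comm]
  · simp
  · rw [hP.charFun_map_powOp hC₀ hp hr hrp]
    simp [hJ, neg_div]

theorem IsGaussianWith.map_inner_map_powOp (hC₀ : IsTraceClassEigensystem C₀ e lam)
    {P : Measure U} (hP : IsGaussianWith P 0 C₀) {p r : ℝ}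
    (hp : Summable fun k => lam k ^ (1 + 2 * p)) (hr : 0 ≤ r) (hrp : 2 * r = 1 + 2 * p) (g : U) :
    (P.map (powOp e lam p)).map (fun w => ⟪g, w⟫) = gaussianReal 0 (‖powOp e lam r g‖₊ ^ 2) := by
  have := hC₀.countable
  have := hP.isGaussian
  obtain ⟨K, hK⟩ := hC₀.exists_bound
  have := hP.isGaussian_map_powOp hC₀ hp hr hrp
  refine Measure.ext_of_charFun (funext fun s => ?_)
  rw [charFun_apply, integral_map (by fun_prop) (by fun_prop), charFun_gaussianReal]
  have h := hP.charFun_map_powOp hC₀ hp hr hrp (s • g)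
  rw [(inPowDomain_of_nonneg (e := e) hC₀.pos hK hr g).powOp_smul, charFun_apply] at h
  simp only [real_inner_smul_right, real_inner_comm g] at h
  convert h using 3
  · simp [mul_comm]
  · simp [norm_smul, mul_pow]
    ring

/-- Fernique's theorem for the Gaussian image under C₀^p, followed by Young's inequality. -/
theorem IsGaussianWith.integrable_exp_mul_norm_powOp (hC₀ : IsTraceClassEigensystem C₀ e lam)
    {P : Measure U} (hP : IsGaussianWith P 0 C₀) {p r : ℝ}
    (hp : Summable fun k => lam k ^ (1 + 2 * p)) (hr : 0 ≤ r) (hrp : 2 * r = 1 + 2 * p) (c : ℝ) :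
    Integrable (fun u => Real.exp (c * ‖powOp e lam p u‖)) P := by
  have := hC₀.countable
  have := hP.isGaussian
  have hm := aemeasurable_powOp (hP.ae_inPowDomain hC₀ hp)
  have := hP.isGaussian_map_powOp hC₀ hp hr hrp
  obtain ⟨δ, hδ, hint⟩ := IsGaussian.exists_integrable_exp_sq (P.map (powOp e lam p))
  suffices h : Integrable (fun w => Real.exp (c * ‖w‖)) (P.map (powOp e lam p)) from
    h.comp_aemeasurable hm
  refine (hint.const_mul (Real.exp (c ^ 2 / (4 * δ)))).mono' (by fun_prop)
    (ae_of_all _ fun w => ?_)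
  rw [Real.norm_eq_abs, Real.abs_exp, ← Real.exp_add]
  exact Real.exp_le_exp.2 (Real.mul_le_sq_div_add_mul_sq hδ _ _)

theorem IsGaussianWith.integral_exp_inner_powOp (hC₀ : IsTraceClassEigensystem C₀ e lam)
    {P : Measure U} (hP : IsGaussianWith P 0 C₀) {p r : ℝ}
    (hp : Summable fun k => lam k ^ (1 + 2 * p)) (hr : 0 ≤ r) (hrp : 2 * r = 1 + 2 * p) (g : U) :
    ∫ u, Real.exp ⟪g, powOp e lam p u⟫ ∂P = Real.exp (‖powOp e lam r g‖ ^ 2 / 2) := by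
  have := hC₀.countable
  have h := mgf_gaussianReal (hP.map_inner_map_powOp hC₀ hp hr hrp g) 1
  rw [mgf, integral_map (aemeasurable_powOp (hP.ae_inPowDomain hC₀ hp)) (by fun_prop)] at h
  simpa using h

theorem IsGaussianWith.integrable_exp_inner_powOp (hC₀ : IsTraceClassEigensystem C₀ e lam)
    {P : Measure U} (hP : IsGaussianWith P 0 C₀) {p r : ℝ}
    (hp : Summable fun k => lam k ^ (1 + 2 * p)) (hr : 0 ≤ r) (hrp : 2 * r = 1 + 2 * p) (g : U) :
    Integrable (fun u => Real.exp ⟪g, powOp e lam p u⟫) P := by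
  have := hC₀.countable
  have hm := aemeasurable_powOp (hP.ae_inPowDomain hC₀ hp)
  refine (hP.integrable_exp_mul_norm_powOp hC₀ hp hr hrp ‖g‖).mono' ?_ (ae_of_all _ fun u => ?_)
  · exact (Real.measurable_exp.comp_aemeasurable (hm.const_inner)).aestronglyMeasurable
  · rw [Real.norm_eq_abs, Real.abs_exp]
    exact Real.exp_le_exp.2 (real_inner_le_norm _ _)

theorem IsGaussianWith.map_inner {P : Measure U} {h : U} {C : U →L[ℝ] U}
    (hP : IsGaussianWith P h C) (v : U) :
    P.map (fun u => ⟪v, u⟫) = gaussianReal ⟪v, h⟫ ⟪C v, v⟫.toNNReal := by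
  have := hP.isGaussian
  have hnn : 0 ≤ ⟪v, C v⟫ :=
    real_inner_comm v (C v) ▸ hP.cov v v ▸ covarianceBilin_self_nonneg v
  refine Measure.ext_of_charFun (funext fun s => ?_)
  rw [charFun_apply, integral_map (by fun_prop) (by fun_prop), charFun_gaussianReal]
  have h := hP.charFun_eq (s • v)
  rw [charFun_apply] at h
  simp only [real_inner_smul_right, real_inner_smul_left, real_inner_comm v, map_smul] at h
  convert h using 3
  · simp [mul_comm]
  · simp [real_inner_comm]
  · simp only [real_inner_comm v (C v), Real.coe_toNNReal _ hnn]
    push_cast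
    ring

/-- **Cameron–Martin formula** for shifts in the domain of `C₀ ^ q`. -/
theorem IsGaussianWith.eq_withDensity (hC₀ : IsTraceClassEigensystem C₀ e lam)
    {P₀ P : Measure U} (hP₀ : IsGaussianWith P₀ 0 C₀) {p q r : ℝ}
    (hp : Summable fun k => lam k ^ (1 + 2 * p)) (hr : 0 ≤ r) (hrp : 2 * r = 1 + 2 * p)
    (hpq : p + q = -1) (hp0 : p ≤ 0) {h : U} (hP : IsGaussianWith P h C₀)
    (hh : InPowDomain e lam q h) :
    P = P₀.withDensity fun u => ENNReal.ofReal (Real.exp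
      (⟪powOp e lam q h, powOp e lam p u⟫ - ‖powOp e lam r (powOp e lam q h)‖ ^ 2 / 2)) := by
  have := hC₀.countable
  have := hP₀.isGaussian
  have := hP.isGaussian
  obtain ⟨K, hK⟩ := hC₀.exists_bound
  have hd := fun {a : ℝ} (ha : 0 ≤ a) v =>
    inPowDomain_of_nonneg (e := e) hC₀.pos hK ha v
  have hdom := hP₀.ae_inPowDomain hC₀ hp
  have hm := aemeasurable_powOp hdom
  set g := powOp e lam q h
  set c := ‖powOp e lam r g‖ ^ 2 / 2 with hc
  have hmρ : AEMeasurable (fun u => ENNReal.ofReal (Real.exp (⟪g, powOp e lam p u⟫ - c))) P₀ :=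
    (Real.measurable_exp.comp_aemeasurable (hm.const_inner.sub_const c)).ennreal_ofReal
  have hint : Integrable (fun u => Real.exp (⟪g, powOp e lam p u⟫ - c)) P₀ := by
    simp_rw [Real.exp_sub]
    exact (hP₀.integrable_exp_inner_powOp hC₀ hp hr hrp g).div_const _
  have := isFiniteMeasure_withDensity_ofReal hint.2
  -- The tilted measure and the shifted Gaussian are compared through the moment generating
  -- functions of all ⟪v, ·⟫. The exponent stays linear in C₀^p u because ⟪v, u⟫ = ⟪C₀^(-p) v, C₀^p
  -- u⟫, with C₀^(-p) bounded.
  have hmgf : ∀ v s, ∫ u, Real.exp (s * ⟪v, u⟫) ∂(P₀.withDensity fun u =>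
      ENNReal.ofReal (Real.exp (⟪g, powOp e lam p u⟫ - c))) =
      Real.exp (⟪v, h⟫ * s + ⟪C₀ v, v⟫ * s ^ 2 / 2) := fun v s => by
    have hv := hd (neg_nonneg.2 hp0) v
    rw [integral_withDensity_eq_integral_toReal_smul₀ hmρ (by simp)]
    have h1 : ∀ᵐ u ∂P₀, (ENNReal.ofReal (Real.exp (⟪g, powOp e lam p u⟫ - c))).toReal •
        Real.exp (s * ⟪v, u⟫) =
        Real.exp (-c) * Real.exp ⟪s • powOp e lam (-p) v + g, powOp e lam p u⟫ := by
      filter_upwards [hdom] with u hu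
      have h2 := hv.inner_powOp_powOp hC₀.pos hu (inPowDomain_zero v) (inPowDomain_zero u)
        (by ring)
      rw [powOp_zero_exponent, powOp_zero_exponent] at h2
      rw [ENNReal.toReal_ofReal (Real.exp_pos _).le, smul_eq_mul, ← Real.exp_add, ← Real.exp_add,
        inner_add_left, real_inner_smul_left, h2]
      ring_nf
    rw [integral_congr_ae h1, integral_const_mul, hP₀.integral_exp_inner_powOp hC₀ hp hr hrp,
      ← Real.exp_add]
    -- Here r - p = 1/2 and r + q = -1/2: the cross term of the squared norm is ⟪v, h⟫, and the
    -- quadratic term in v is the variance ⟪C₀ v, v⟫.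
    have hv' := hd (show 0 ≤ r + -p by linarith) v
    have hh' : InPowDomain e lam (r + q) h := (inPowDomain_powOp_iff hC₀.pos hh).1 (hd hr _)
    have h3 : powOp e lam r (powOp e lam (-p) v) = powOp e lam (r + -p) v :=
      hv.powOp_powOp hC₀.pos hv'
    have h4 : powOp e lam r g = powOp e lam (r + q) h := hh.powOp_powOp hC₀.pos hh'
    have h5 : ⟪powOp e lam (r + -p) v, powOp e lam (r + q) h⟫ = ⟪v, h⟫ := by
      rw [hv'.inner_powOp_powOp hC₀.pos hh' (inPowDomain_zero v) (inPowDomain_zero h)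
        (by linarith), powOp_zero_exponent, powOp_zero_exponent]
    have h6 : ‖powOp e lam (r + -p) v‖ ^ 2 = ⟪C₀ v, v⟫ := by
      rw [← real_inner_self_eq_norm_sq, hv'.inner_powOp_powOp hC₀.pos hv'
        (hd zero_le_one v) (inPowDomain_zero v) (by linarith), powOp_zero_exponent, hC₀.apply_eq]
    have h7 : ‖powOp e lam r (s • powOp e lam (-p) v + g)‖ ^ 2 / 2 =
        c + (⟪v, h⟫ * s + ⟪C₀ v, v⟫ * s ^ 2 / 2) := by
      rw [(hd hr _).powOp_add (hd hr _), (hd hr _).powOp_smul, norm_add_sq_real, hc, h3,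
        real_inner_smul_left, h4, h5, norm_smul, mul_pow, h6, Real.norm_eq_abs, sq_abs]
      ring
    rw [h7]
    ring_nf
  have hprob : ∀ v s, mgf (fun u => ⟪v, u⟫) P s =
      Real.exp (⟪v, h⟫ * s + ⟪C₀ v, v⟫ * s ^ 2 / 2) := fun v s => by
    rw [mgf_gaussianReal (hP.map_inner v),
      Real.coe_toNNReal _ (hP.cov v v ▸ covarianceBilin_self_nonneg v)]
  refine Measure.ext_of_charFun (funext fun v => ?_)
  -- Equality of the real generating functions extends analytically to the strip over the
  -- integrability domain; its value at the imaginary unit is the characteristic function.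
  have heq := eqOn_complexMGF_of_mgf (X := fun u => ⟪v, u⟫) (μ := P)
    (funext fun s => (hprob v s).trans (hmgf v s).symm)
  -- A non-integrable exponential would have integral 0 by convention, contradicting the positive
  -- value of the generating function.
  have huniv : integrableExpSet (fun u => ⟪v, u⟫) P = Set.univ :=
    Set.eq_univ_of_forall fun s => by
      by_contra hs
      exact (Real.exp_pos _).ne' ((hprob v s).symm.trans (integral_undef hs))
  have h1 := heq (x := ((1 : ℝ) : ℂ) * Complex.I) (by simp [huniv])
  simp only [complexMGF] at h1
  simp only [charFun_apply]
  convert h1 using 4 <;> simp [real_inner_comm, mul_comm]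

end GaussianScale

/-! ### Hellinger distance and dominated convergence of posteriors. -/

section HellingerContinuity

variable {U : Type*} [MeasurableSpace U]

theorem hellingerDist_nonneg (μ ν : Measure U) : 0 ≤ hellingerDist μ ν := Real.sqrt_nonneg _

theorem Real.sq_sqrt_sub_sqrt_le_abs_sub {a b : ℝ} (ha : 0 ≤ a) (hb : 0 ≤ b) :
    (√a - √b) ^ 2 ≤ |a - b| := by
  have h : a - b = (√a - √b) * (√a + √b) := by
    linear_combination -Real.sq_sqrt ha + Real.sq_sqrt hb
  rw [h, abs_mul, abs_of_nonneg (add_nonneg (Real.sqrt_nonneg a) (Real.sqrt_nonneg b)), ← sq_abs,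
    sq]
  refine mul_le_mul_of_nonneg_left ?_ (abs_nonneg _)
  exact abs_le.2 ⟨by linarith [Real.sqrt_nonneg a], by linarith [Real.sqrt_nonneg b]⟩

/-- The Hellinger distance is controlled by the `L¹` distance of densities. -/
theorem hellingerDist_le {P₀ μ ν : Measure U} {p q : U → ℝ} (hp : Integrable p P₀)
    (hq : Integrable q P₀) (hp0 : ∀ u, 0 ≤ p u) (hq0 : ∀ u, 0 ≤ q u)
    (hμ : μ = P₀.withDensity fun u => ENNReal.ofReal (p u))
    (hν : ν = P₀.withDensity fun u => ENNReal.ofReal (q u)) :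
    hellingerDist μ ν ≤ √((1 / 2) * ∫ u, |p u - q u| ∂P₀) := by
  have : IsFiniteMeasure μ := hμ ▸ isFiniteMeasure_withDensity_ofReal hp.2
  have : IsFiniteMeasure ν := hν ▸ isFiniteMeasure_withDensity_ofReal hq.2
  have hreal : ∀ {r : U → ℝ} {κ : Measure U}, Integrable r P₀ → (∀ u, 0 ≤ r u) →
      κ = P₀.withDensity (fun u => ENNReal.ofReal (r u)) → ∀ A, MeasurableSet A →
      κ.real A = ∫ u in A, r u ∂P₀ := fun {r κ} hr hr0 hκ A hA => by
    rw [hκ, measureReal_def, withDensity_apply _ hA,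
      integral_eq_lintegral_of_nonneg_ae (ae_of_all _ hr0) hr.1.restrict]
  set a := fun u => (μ.rnDeriv (μ + ν) u).toReal
  set b := fun u => (ν.rnDeriv (μ + ν) u).toReal
  have ha : Integrable a (μ + ν) := Measure.integrable_toReal_rnDeriv
  have hb : Integrable b (μ + ν) := Measure.integrable_toReal_rnDeriv
  have ha' : ∀ A, ∫ u in A, a u ∂(μ + ν) = μ.real A := fun A =>
    Measure.setIntegral_toReal_rnDeriv (Measure.absolutelyContinuous_of_le
      (Measure.le_add_right le_rfl)) A
  have hb' : ∀ A, ∫ u in A, b u ∂(μ + ν) = ν.real A := fun A =>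
    Measure.setIntegral_toReal_rnDeriv (Measure.absolutelyContinuous_of_le
      (Measure.le_add_left le_rfl)) A
  have hA : MeasurableSet {u | b u ≤ a u} :=
    measurableSet_le (Measure.measurable_rnDeriv _ _).ennreal_toReal
      (Measure.measurable_rnDeriv _ _).ennreal_toReal
  set A := {u | b u ≤ a u}
  -- No chain rule for Radon–Nikodym derivatives is needed: on A, and on its complement with the
  -- roles exchanged, the integral of |a - b| is μ(A) - ν(A), which is also the integral of p - q
  -- over A.
  have h1 : ∫ u, |a u - b u| ∂(μ + ν) ≤ ∫ u, |p u - q u| ∂P₀ := by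
    have hab : Integrable (fun u => |a u - b u|) (μ + ν) := (ha.sub hb).abs
    have hpq : Integrable (fun u => |p u - q u|) P₀ := (hp.sub hq).abs
    rw [← integral_add_compl hA hab, ← integral_add_compl hA hpq]
    refine add_le_add ?_ ?_
    · have h2 : ∫ u in A, |a u - b u| ∂(μ + ν) = ∫ u in A, (a u - b u) ∂(μ + ν) :=
        setIntegral_congr_fun hA fun u hu => abs_of_nonneg (sub_nonneg.2 hu)
      rw [h2, integral_sub ha.integrableOn hb.integrableOn, ha', hb', hreal hp hp0 hμ A hA,
        hreal hq hq0 hν A hA, ← integral_sub hp.integrableOn hq.integrableOn]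
      exact integral_mono (hp.sub hq).integrableOn (hp.sub hq).abs.integrableOn
        fun u => le_abs_self _
    · have h2 : ∫ u in Aᶜ, |a u - b u| ∂(μ + ν) = ∫ u in Aᶜ, (b u - a u) ∂(μ + ν) :=
        setIntegral_congr_fun hA.compl fun u hu => by
          rw [abs_sub_comm]
          exact abs_of_nonneg (sub_nonneg.2 (not_le.1 (show ¬b u ≤ a u from hu)).le)
      rw [h2, integral_sub hb.integrableOn ha.integrableOn, ha', hb', hreal hp hp0 hμ _ hA.compl,
        hreal hq hq0 hν _ hA.compl, ← integral_sub hq.integrableOn hp.integrableOn]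
      exact integral_mono (hq.sub hp).integrableOn (hp.sub hq).abs.integrableOn
        fun u => (le_abs_self _).trans_eq (abs_sub_comm _ _)
  refine Real.sqrt_le_sqrt (mul_le_mul_of_nonneg_left (le_trans ?_ h1) (by norm_num))
  refine integral_mono_of_nonneg (ae_of_all _ fun u => sq_nonneg _) (ha.sub hb).abs
    (ae_of_all _ fun u => ?_)
  exact Real.sq_sqrt_sub_sqrt_le_abs_sub ENNReal.toReal_nonneg ENNReal.toReal_nonneg

/-- Well-posedness for priors with densities `ρ S` relative to a reference measure, from pointwise
continuity in the data and local domination of the unnormalized posterior densities. -/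
theorem bayesWellPosed_of_dominated {X Y : Type*} [TopologicalSpace X] [TopologicalSpace Y]
    [FirstCountableTopology X] [FirstCountableTopology Y] {m : ℕ} {β : ℝ} {Φ : U → X → Y → ℝ}
    {P : (Fin m → X × Y) → Measure U} {P₀ : Measure U} [IsProbabilityMeasure P₀]
    (ρ : (Fin m → X × Y) → U → ℝ) (hρ : ∀ S u, 0 < ρ S u)
    (hP : ∀ S, P S = P₀.withDensity fun u => ENNReal.ofReal (ρ S u))
    (hρm : ∀ S, AEMeasurable (ρ S) P₀)
    (hΦm : ∀ S : Fin m → X × Y, AEMeasurable (fun u => ∑ j, Φ u (S j).1 (S j).2) P₀)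
    (hcont : ∀ S₀ : Fin m → X × Y, ∀ᵐ u ∂P₀, Tendsto (fun S => ρ S u) (𝓝 S₀) (𝓝 (ρ S₀ u)) ∧
      Tendsto (fun S : Fin m → X × Y => ∑ j, Φ u (S j).1 (S j).2) (𝓝 S₀)
        (𝓝 (∑ j, Φ u (S₀ j).1 (S₀ j).2)))
    (hdom : ∀ S₀ : Fin m → X × Y, ∃ g : U → ℝ, Integrable g P₀ ∧ ∀ᶠ S in 𝓝 S₀, ∀ᵐ u ∂P₀,
      ρ S u * Real.exp (-(β / m) * ∑ j, Φ u (S j).1 (S j).2) ≤ g u) :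
    BayesWellPosed β Φ P := by
  set a : (Fin m → X × Y) → U → ℝ :=
    fun S u => ρ S u * Real.exp (-(β / m) * ∑ j, Φ u (S j).1 (S j).2)
  have ha0 : ∀ S u, 0 < a S u := fun S u => mul_pos (hρ S u) (Real.exp_pos _)
  have hLm : ∀ S, AEMeasurable (likelihood β Φ S) P₀ := fun S =>
    (Real.measurable_exp.comp_aemeasurable ((hΦm S).const_mul _)).ennreal_ofReal
  have ham : ∀ S, AEMeasurable (a S) P₀ := fun S =>
    (hρm S).mul (Real.measurable_exp.comp_aemeasurable ((hΦm S).const_mul _))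
  have hai : ∀ S, Integrable (a S) P₀ := fun S => by
    obtain ⟨g, hg, hle⟩ := hdom S
    refine hg.mono' (ham S).aestronglyMeasurable ?_
    filter_upwards [hle.self_of_nhds] with u hu
    rwa [Real.norm_eq_abs, abs_of_pos (ha0 S u)]
  set Z : (Fin m → X × Y) → ℝ := fun S => ∫ u, a S u ∂P₀
  have hZ0 : ∀ S, 0 < Z S := fun S => by
    refine (integral_pos_iff_support_of_nonneg (fun u => (ha0 S u).le) (hai S)).2 ?_
    rw [Set.eq_univ_of_forall (s := Function.support (a S)) fun u => (ha0 S u).ne']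
    simp
  have hac : ∀ S, P S ≪ P₀ := fun S => hP S ▸ withDensity_absolutelyContinuous _ _
  have hρm' : ∀ S, AEMeasurable (fun u => ENNReal.ofReal (ρ S u)) P₀ := fun S =>
    (hρm S).ennreal_ofReal
  have hmul : ∀ S u, ENNReal.ofReal (ρ S u) * likelihood β Φ S u = ENNReal.ofReal (a S u) :=
    fun S u => (ENNReal.ofReal_mul (hρ S u).le).symm
  have hnorm : ∀ S, normalizingConstant β Φ S (P S) = ENNReal.ofReal (Z S) := fun S => by
    rw [normalizingConstant, hP, lintegral_withDensity_eq_lintegral_mul₀ (hρm' S) (hLm S),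
      ofReal_integral_eq_lintegral_ofReal (hai S) (ae_of_all _ fun u => (ha0 S u).le)]
    exact lintegral_congr fun u => hmul S u
  have hpost : ∀ S, basePosterior β Φ S (P S) =
      P₀.withDensity fun u => ENNReal.ofReal (a S u / Z S) := fun S => by
    rw [basePosterior, hnorm, hP, ← withDensity_mul₀ (hρm' S) ((hLm S).const_mul _)]
    congr 1
    funext u
    rw [Pi.mul_apply, mul_left_comm, hmul, ENNReal.ofReal_div_of_pos (hZ0 S), div_eq_mul_inv,
      mul_comm]
  refine ⟨fun S => ⟨(hLm S).mono_ac (hac S), ?_, ?_, ⟨?_⟩⟩, fun S₀ => ?_⟩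
  · rw [hnorm]
    exact ENNReal.ofReal_pos.2 (hZ0 S)
  · rw [hnorm]
    exact ENNReal.ofReal_lt_top
  · rw [hpost, withDensity_apply _ MeasurableSet.univ, Measure.restrict_univ,
      ← ofReal_integral_eq_lintegral_ofReal ((hai S).div_const _)
        (ae_of_all _ fun u => (div_pos (ha0 S u) (hZ0 S)).le), integral_div]
    change ENNReal.ofReal (Z S / Z S) = 1
    rw [div_self (hZ0 S).ne', ENNReal.ofReal_one]
  · obtain ⟨g, hg, hle⟩ := hdom S₀
    have hlim : ∀ᵐ u ∂P₀, Tendsto (fun S => a S u) (𝓝 S₀) (𝓝 (a S₀ u)) := by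
      filter_upwards [hcont S₀] with u hu
      exact hu.1.mul ((Real.continuous_exp.tendsto _).comp (hu.2.const_mul _))
    have hZlim : Tendsto Z (𝓝 S₀) (𝓝 (Z S₀)) := by
      refine tendsto_integral_filter_of_dominated_convergence g
        (.of_forall fun S => (hai S).1) ?_ hg hlim
      filter_upwards [hle] with S hS
      filter_upwards [hS] with u hu
      rwa [Real.norm_eq_abs, abs_of_pos (ha0 S u)]
    -- Keeps the denominators away from 0, so that the normalized densities are dominated uniformly
    -- for S near S₀.
    have hZlow : ∀ᶠ S in 𝓝 S₀, Z S₀ / 2 < Z S :=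
      hZlim.eventually (lt_mem_nhds (half_lt_self (hZ0 S₀)))
    have hL1 : Tendsto (fun S => ∫ u, |a S u / Z S - a S₀ u / Z S₀| ∂P₀) (𝓝 S₀) (𝓝 0) := by
      rw [← integral_zero U ℝ (μ := P₀)]
      refine tendsto_integral_filter_of_dominated_convergence
        (fun u => g u / (Z S₀ / 2) + a S₀ u / Z S₀)
        (.of_forall fun S => (((hai S).div_const _).sub ((hai S₀).div_const _)).abs.1) ?_
        ((hg.div_const _).add ((hai S₀).div_const _)) ?_
      · filter_upwards [hle, hZlow] with S hS hSZ
        filter_upwards [hS] with u hu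
        rw [Real.norm_eq_abs, abs_abs]
        refine (abs_sub _ _).trans (add_le_add ?_ (abs_of_pos (div_pos (ha0 _ _) (hZ0 _))).le)
        rw [abs_of_pos (div_pos (ha0 _ _) (hZ0 _))]
        have := hZ0 S₀
        exact div_le_div₀ ((ha0 S u).le.trans hu) hu (by positivity) hSZ.le
      · filter_upwards [hlim] with u hu
        have h := ((hu.div hZlim (hZ0 S₀).ne').sub_const (a S₀ u / Z S₀)).abs
        simpa using h
    refine squeeze_zero (fun S => hellingerDist_nonneg _ _) (fun S => hellingerDist_le
      ((hai S).div_const (Z S)) ((hai S₀).div_const (Z S₀))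
      (fun u => (div_pos (ha0 S u) (hZ0 S)).le) (fun u => (div_pos (ha0 S₀ u) (hZ0 S₀)).le)
      (hpost S) (hpost S₀)) ?_
    have h := (hL1.const_mul (1 / 2)).sqrt
    simpa using h

end HellingerContinuity

/-! ### Continuity of the forward maps. -/

section ForwardMaps

variable {ι U H X : Type*} [NormedAddCommGroup U] [InnerProductSpace ℝ U]
  [NormedAddCommGroup H] [TopologicalSpace X] {e : HilbertBasis ι ℝ U} {lam : ι → ℝ} {t : ℝ}
  {A : H → H} {F : X → U → H} {M₁ : ℝ≥0 → ℝ≥0} {M₂ : ℝ≥0 → ℝ≥0 → ℝ≥0}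

theorem ForwardBounds.continuous_space (hF : ForwardBounds e lam t A F M₁ M₂)
    (hA : ∀ x x' u u', InScale e lam t u → InScale e lam t u' →
      A (F x u - F x' u') = A (F x u) - A (F x' u')) {u : U} (hu : InScale e lam t u) :
    Continuous fun x => A (F x u) := by
  refine continuous_iff_continuousAt.2 fun x₀ => tendsto_iff_norm_sub_tendsto_zero.2 ?_
  simpa only [hA _ _ _ _ hu hu] using hF.continuous u hu x₀

/-- The map J will be C₀^((1-s̃)/2), which is isometric from U to U^(1-s̃). Continuity in the scale
norm thereby becomes continuity on U itself, from which measurability follows. -/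
theorem ForwardBounds.continuous_scale (hF : ForwardBounds e lam t A F M₁ M₂)
    (hA : ∀ x x' u u', InScale e lam t u → InScale e lam t u' →
      A (F x u - F x' u') = A (F x u) - A (F x' u')) {J : U → U}
    (hJ : ∀ w, InScale e lam t (J w)) (hJn : ∀ w, scaleNorm e lam t (J w) = ‖w‖₊)
    (hJs : ∀ w w', scaleNorm e lam t (J w - J w') = ‖w - w'‖₊) (x : X) :
    Continuous fun w => A (F x (J w)) := by
  refine continuous_iff_continuousAt.2 fun w₀ => tendsto_iff_norm_sub_tendsto_zero.2 ?_
  have hle : ∀ᶠ w in 𝓝 w₀, ‖A (F x (J w)) - A (F x (J w₀))‖ ≤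
      -- Monotonicity of M₂ makes this a Lipschitz constant towards w₀ for all w with ‖w‖ < ‖w₀‖ +
      -- 1.
      M₂ (‖w₀‖₊ + 1) ‖w₀‖₊ * ‖w - w₀‖ := by
    have hnear : ∀ᶠ w in 𝓝 w₀, ‖w‖₊ < ‖w₀‖₊ + 1 :=
      (continuous_nnnorm.tendsto w₀).eventually (gt_mem_nhds (lt_add_one _))
    filter_upwards [hnear] with w hw
    have h := hF.lipschitz x _ _ (hJ w) (hJ w₀)
    rw [hA _ _ _ _ (hJ w) (hJ w₀), hJn, hJn, hJs] at h
    exact_mod_cast h.trans (mul_le_mul_left (hF.mono₂_left _ hw.le) _)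
  refine squeeze_zero' (.of_forall fun _ => norm_nonneg _) hle ?_
  have h := (tendsto_iff_norm_sub_tendsto_zero.1 (tendsto_id (x := 𝓝 w₀))).const_mul
    (M₂ (‖w₀‖₊ + 1) ‖w₀‖₊ : ℝ)
  simpa using h

end ForwardMaps

/-! ### Well-posedness for the data-dependent prior. -/

section Prior

variable {ι U : Type*} [NormedAddCommGroup U] [InnerProductSpace ℝ U] [CompleteSpace U]
  [SecondCountableTopology U] [MeasurableSpace U] [BorelSpace U]
  {C₀ : U →L[ℝ] U} {e : HilbertBasis ι ℝ U} {lam : ι → ℝ} {P₀ : Measure U} {st : ℝ}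

omit [SecondCountableTopology U] in
theorem IsDataDependentPrior.tendsto_powOp {D : Type*} [TopologicalSpace D] {f : D → U}
    {P : D → Measure U} (h : IsDataDependentPrior C₀ e lam st f P) (S₀ : D) :
    Tendsto (fun S => powOp e lam (-(1 + st) / 2) (f S)) (𝓝 S₀)
      (𝓝 (powOp e lam (-(1 + st) / 2) (f S₀))) := by
  rw [tendsto_iff_norm_sub_tendsto_zero]
  have h' := (NNReal.continuous_coe.tendsto 0).comp (h.continuous S₀)
  refine h'.congr fun S => ?_
  rw [← (h.mem_scale S).powOp_sub (h.mem_scale S₀)]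
  rfl

/-- Under linear growth the claim reduces to Fernique's theorem in U^(1-s̃); under the
square-exponential hypothesis Young's inequality suffices. -/
theorem IsGaussianWith.integrable_exp_mul_scaleNorm_comp
    (hC₀ : IsTraceClassEigensystem C₀ e lam) (hP₀ : IsGaussianWith P₀ 0 C₀)
    (hst : traceExponent lam < st) {M : ℝ≥0 → ℝ≥0} (hM : Monotone M)
    (hgrowth : (∃ a b : ℝ≥0, ∀ r, M r ≤ a + b * r) ∨ ∃ δ : ℝ, 0 < δ ∧
      Integrable (fun u => Real.exp (δ * (M (scaleNorm e lam (1 - st) u) : ℝ) ^ 2)) P₀) (c : ℝ) :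
    Integrable (fun u => Real.exp (c * M (scaleNorm e lam (1 - st) u))) P₀ := by
  have := hC₀.countable
  have := hP₀.isGaussian
  have hp : Summable fun k => lam k ^ (1 + 2 * (-(1 - st) / 2)) := by
    convert summable_rpow_of_traceExponent_lt hC₀.pos hC₀.trace hst using 3
    ring
  have hst0 := (traceExponent_nonneg lam).trans hst.le
  have hm : AEMeasurable (fun u => Real.exp (c * M (scaleNorm e lam (1 - st) u))) P₀ := by
    have h := hM.measurable.comp_aemeasurable
      (aemeasurable_powOp (hP₀.ae_inPowDomain hC₀ hp)).nnnorm
    exact Real.measurable_exp.comp_aemeasurable (h.coe_nnreal_real.const_mul c)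
  obtain ⟨a, b, hab⟩ | ⟨δ, hδ, hint⟩ := hgrowth
  · refine ((hP₀.integrable_exp_mul_norm_powOp hC₀ hp (r := st / 2) (by linarith) (by ring)
      (|c| * b)).const_mul (Real.exp (|c| * a))).mono' hm.aestronglyMeasurable
      (ae_of_all _ fun u => ?_)
    rw [Real.norm_eq_abs, Real.abs_exp, ← Real.exp_add]
    refine Real.exp_le_exp.2 ?_
    have h : (M (scaleNorm e lam (1 - st) u) : ℝ) ≤ a + b * ‖powOp e lam (-(1 - st) / 2) u‖ :=
      mod_cast hab (scaleNorm e lam (1 - st) u)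
    calc c * M (scaleNorm e lam (1 - st) u) ≤ |c| * M (scaleNorm e lam (1 - st) u) :=
          mul_le_mul_of_nonneg_right (le_abs_self c) (NNReal.coe_nonneg _)
      _ ≤ |c| * (a + b * ‖powOp e lam (-(1 - st) / 2) u‖) :=
          mul_le_mul_of_nonneg_left h (abs_nonneg c)
      _ = _ := by ring
  · refine (hint.const_mul (Real.exp (c ^ 2 / (4 * δ)))).mono' hm.aestronglyMeasurable
      (ae_of_all _ fun u => ?_)
    rw [Real.norm_eq_abs, Real.abs_exp, ← Real.exp_add]
    exact Real.exp_le_exp.2 (Real.mul_le_sq_div_add_mul_sq hδ _ _)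

/-- Well-posedness for a potential that is continuous in the data and in the scale norm of the
unknown, and bounded below by `-b(y) N(u)` with all exponential moments of `N` finite. -/
theorem IsDataDependentPrior.bayesWellPosed {X Y : Type*} [TopologicalSpace X]
    [TopologicalSpace Y] [FirstCountableTopology X] [FirstCountableTopology Y]
    (hC₀ : IsTraceClassEigensystem C₀ e lam) (hP₀ : IsGaussianWith P₀ 0 C₀)
    (hst : traceExponent lam < st) (hst1 : st ≤ 1) {m : ℕ} {β : ℝ} (hβ : 0 < β)
    {Φ : U → X → Y → ℝ} {f : (Fin m → X × Y) → U} {P : (Fin m → X × Y) → Measure U}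
    (hP : IsDataDependentPrior C₀ e lam st f P)
    (hΦu : ∀ x y, Continuous fun w => Φ (powOp e lam ((1 - st) / 2) w) x y)
    (hΦS : ∀ u, InScale e lam (1 - st) u → Continuous fun z : X × Y => Φ u z.1 z.2)
    {b : Y → ℝ} (hb : Continuous b) {N : U → ℝ} (hN0 : ∀ u, 0 ≤ N u)
    (hN : ∀ c, Integrable (fun u => Real.exp (c * N u)) P₀)
    (hlow : ∀ u x y, InScale e lam (1 - st) u → -(b y * N u) ≤ Φ u x y) :
    BayesWellPosed β Φ P := by
  have := hC₀.countable
  have := hP₀.isGaussian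
  obtain ⟨K, hK⟩ := hC₀.exists_bound
  have hst0 := (traceExponent_nonneg lam).trans hst.le
  set p := -(1 - st) / 2 with hpdef
  set q := -(1 + st) / 2 with hqdef
  have hp : Summable fun k => lam k ^ (1 + 2 * p) := by
    convert summable_rpow_of_traceExponent_lt hC₀.pos hC₀.trace hst using 3
    rw [hpdef]
    ring
  have hr : 0 ≤ st / 2 := by linarith
  have hrp : 2 * (st / 2) = 1 + 2 * p := by rw [hpdef]; ring
  have hdom : ∀ᵐ u ∂P₀, InScale e lam (1 - st) u := hP₀.ae_inPowDomain hC₀ hp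
  have hm : AEMeasurable (powOp e lam p) P₀ := aemeasurable_powOp hdom
  obtain ⟨B, hB⟩ := exists_powOp_eq_continuousLinearMap e hC₀.pos hK hr
  refine bayesWellPosed_of_dominated (P₀ := P₀) (fun S u => Real.exp
      (⟪powOp e lam q (f S), powOp e lam p u⟫ -
        ‖powOp e lam (st / 2) (powOp e lam q (f S))‖ ^ 2 / 2))
    (fun S u => Real.exp_pos _) (fun S => ?_) (fun S => ?_) (fun S => ?_) (fun S₀ => ?_)
    (fun S₀ => ?_)
  · exact hP₀.eq_withDensity hC₀ hp hr hrp (by rw [hpdef, hqdef]; ring)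
      (by rw [hpdef]; linarith) (hP.gaussian S) (hP.mem_scale S)
  · exact Real.measurable_exp.comp_aemeasurable (hm.const_inner.sub_const _)
  -- Almost surely u = C₀^((1-s̃)/2) (C₀^p u), so the potential is a continuous function of the
  -- measurable map C₀^p u.
  · have hmΦ : ∀ j, AEMeasurable (fun u => Φ u (S j).1 (S j).2) P₀ := fun j => by
      refine ((hΦu (S j).1 (S j).2).measurable.comp_aemeasurable hm).congr ?_
      filter_upwards [hdom] with u hu
      have h0 : (1 - st) / 2 + p = 0 := by rw [hpdef]; ring
      have h1 := InPowDomain.powOp_powOp hC₀.pos (a := (1 - st) / 2) hu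
        (by rw [h0]; exact inPowDomain_zero u)
      rw [h0, powOp_zero_exponent] at h1
      exact congrArg (fun v => Φ v (S j).1 (S j).2) h1
    exact Finset.aemeasurable_fun_sum _ fun j _ => hmΦ j
  · filter_upwards [hdom] with u hu
    constructor
    · have hg := hP.tendsto_powOp S₀
      refine (Real.continuous_exp.tendsto _).comp
        ((hg.inner tendsto_const_nhds).sub (Tendsto.div_const (Tendsto.pow (Tendsto.norm ?_) 2) 2))
      simp_rw [← hB]
      exact (B.continuous.tendsto _).comp hg
    · refine (continuous_finsetSum _ fun j _ => ?_).tendsto S₀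
      exact (hΦS u hu).comp (continuous_apply j)
  · set c := ‖powOp e lam q (f S₀)‖ + 1
    set d := ∑ j, b (S₀ j).2 + 1
    have hgn : ∀ᶠ S in 𝓝 S₀, ‖powOp e lam q (f S)‖ < c :=
      (hP.tendsto_powOp S₀).norm.eventually (gt_mem_nhds (lt_add_one _))
    have hbn : ∀ᶠ S : Fin m → X × Y in 𝓝 S₀, ∑ j, b (S j).2 < d := by
      have hcont : Continuous fun S : Fin m → X × Y => ∑ j, b (S j).2 := by fun_prop
      exact (hcont.tendsto S₀).eventually (gt_mem_nhds (lt_add_one _))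
    -- The prior density and the likelihood give exp(x + y), which is at most exp(2x) + exp(2y);
    -- this avoids any joint moment of ‖C₀^p u‖ and N(u).
    refine ⟨fun u => Real.exp (2 * c * ‖powOp e lam p u‖) +
        Real.exp (2 * (β / m * d) * N u),
      (hP₀.integrable_exp_mul_norm_powOp hC₀ hp hr hrp _).add (hN _), ?_⟩
    filter_upwards [hgn, hbn] with S hS₁ hS₂
    filter_upwards [hdom] with u hu
    have hβm : 0 ≤ β / m := by positivity
    have h1 : ⟪powOp e lam q (f S), powOp e lam p u⟫ -
        ‖powOp e lam (st / 2) (powOp e lam q (f S))‖ ^ 2 / 2 ≤ c * ‖powOp e lam p u‖ := by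
      have h2 := real_inner_le_norm (powOp e lam q (f S)) (powOp e lam p u)
      have h3 := mul_le_mul_of_nonneg_right hS₁.le (norm_nonneg (powOp e lam p u))
      have h4 := sq_nonneg ‖powOp e lam (st / 2) (powOp e lam q (f S))‖
      linarith
    have h2 : -(β / m) * ∑ j, Φ u (S j).1 (S j).2 ≤ β / m * d * N u := by
      have h3 : -((∑ j, b (S j).2) * N u) ≤ ∑ j, Φ u (S j).1 (S j).2 := by
        rw [Finset.sum_mul, ← Finset.sum_neg_distrib]
        exact Finset.sum_le_sum fun j _ => hlow u _ _ hu
      have h4 := mul_le_mul_of_nonneg_right hS₂.le (hN0 u)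
      have h5 := mul_le_mul_of_nonneg_left (show -(∑ j, Φ u (S j).1 (S j).2) ≤ d * N u by linarith)
        hβm
      linarith
    rw [← Real.exp_add]
    refine (Real.exp_le_exp.2 (add_le_add h1 h2)).trans ?_
    rcases le_total (c * ‖powOp e lam p u‖) (β / m * d * N u) with h | h
    · exact (Real.exp_le_exp.2 (by linarith)).trans
        (le_add_of_nonneg_left (Real.exp_pos (2 * c * ‖powOp e lam p u‖)).le)
    · exact (Real.exp_le_exp.2 (by linarith)).trans
        (le_add_of_nonneg_right (Real.exp_pos (2 * (β / m * d) * N u)).le)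

end Prior

/-! ### Inverting the square root of the noise covariance. -/

section Whitening

variable {κ H : Type*} [NormedAddCommGroup H] [InnerProductSpace ℝ H]

theorem IsPosDefSqrt.injective_sqrt {Γ R : H →L[ℝ] H} (h : IsPosDefSqrt Γ R) :
    Function.Injective R := by
  refine Function.Injective.of_comp (f := R) ?_
  rw [← ContinuousLinearMap.coe_comp, h.sqrt_sq]
  exact h.injective

theorem opInv_apply {R : H →L[ℝ] H} (hR : Function.Injective R) (h : H) : opInv R (R h) = h :=
  Function.leftInverse_invFun hR h

variable {R : H →L[ℝ] H} {φ : HilbertBasis κ ℝ H} {zeta : κ → ℝ} {s : ℝ}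

theorem InWhitenDomain.whiten_sub (hR : Function.Injective R) {v w : H}
    (hv : InWhitenDomain R φ zeta s v) (hw : InWhitenDomain R φ zeta s w) :
    whiten R φ zeta s (v - w) = whiten R φ zeta s v - whiten R φ zeta s w := by
  obtain ⟨⟨v, rfl⟩, hv⟩ := hv
  obtain ⟨⟨w, rfl⟩, hw⟩ := hw
  rw [opInv_apply hR] at hv hw
  simp only [whiten, ← map_sub, opInv_apply hR]
  exact hv.powOp_sub hw

/-- Writes Γ^(-1/2) v as C₁^(s/2) applied to the whitened vector; since C₁^(s/2) is bounded, the
quadratic term of the potential inherits continuity from the whitened forward map. -/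
theorem InWhitenDomain.opInv_eq (hz : ∀ k, 0 < zeta k) {v : H}
    (hv : InWhitenDomain R φ zeta s v) :
    opInv R v = powOp φ zeta (s / 2) (whiten R φ zeta s v) := by
  have h0 : s / 2 + -s / 2 = 0 := by ring
  have h := InPowDomain.powOp_powOp hz (a := s / 2) hv.2 (by rw [h0]; exact inPowDomain_zero _)
  rw [h0, powOp_zero_exponent] at h
  exact h.symm

end Whitening

/-- In finite dimension an injective endomorphism is bijective, so the set-theoretic inverse is
linear and automatically continuous. -/
theorem exists_opInv_eq_continuousLinearMap {E : Type*} [NormedAddCommGroup E]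
    [InnerProductSpace ℝ E] [FiniteDimensional ℝ E] {R : E →L[ℝ] E}
    (hR : Function.Injective R) : ∃ V : E →L[ℝ] E, ∀ v, opInv R v = V v := by
  let B := LinearEquiv.ofInjectiveEndo R.toLinearMap hR
  refine ⟨LinearMap.toContinuousLinearMap (B.symm : E →ₗ[ℝ] E), fun v => hR ?_⟩
  have h : ∀ w, R (B.symm w) = w := B.apply_symm_apply
  exact (Function.invFun_eq ⟨_, h v⟩).trans (h v).symm

/-! ### The two data settings. -/

theorem theorem3p3
    {U : Type*} [NormedAddCommGroup U] [InnerProductSpace ℝ U] [CompleteSpace U]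
    [SecondCountableTopology U] [MeasurableSpace U] [BorelSpace U]
    {ι : Type*} (C₀ : U →L[ℝ] U) (e : HilbertBasis ι ℝ U) (lam : ι → ℝ)
    (hC₀ : IsTraceClassEigensystem C₀ e lam)
    (P₀ : Measure U) (hP₀ : IsGaussianWith P₀ 0 C₀)
    (st : ℝ) (hst : traceExponent lam < st) (hst1 : st ≤ 1)
    {X : Type*} [PseudoMetricSpace X] {W Θ : Type*} (G : U → W)
    (m : ℕ) (hm : 1 ≤ m) (β : ℝ) (hβ : 0 < β) :
    -- data in a Hilbert scale over a separable Hilbert space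
    (∀ {H : Type*} [NormedAddCommGroup H] [InnerProductSpace ℝ H] [CompleteSpace H]
      [SecondCountableTopology H] {κ : Type*}
      (C₁ : H →L[ℝ] H) (φ : HilbertBasis κ ℝ H) (zeta : κ → ℝ)
      (_ : IsTraceClassEigensystem C₁ φ zeta)
      (s : ℝ) (_ : traceExponent zeta < s) (_ : s ≤ 1) (α : ℝ)
      (Γ R : H →L[ℝ] H) (_ : IsPosDefSqrt Γ R)
      (T : HilbertScale zeta (α - s) →L[ℝ] H) (_ : IsWhitenedDataOp R φ zeta s T)
      (L : X → W → H) (M₁ : ℝ≥0 → ℝ≥0) (M₂ : ℝ≥0 → ℝ≥0 → ℝ≥0)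
      (_ : ∀ x u, InScale e lam (1 - st) u → InWhitenDomain R φ zeta s (L x (G u)))
      (_ : ForwardBounds e lam (1 - st) (whiten R φ zeta s) (fun x u => L x (G u)) M₁ M₂)
      (_ : (∃ a b : ℝ≥0, ∀ r, M₁ r ≤ a + b * r) ∨
        ∃ δ : ℝ, 0 < δ ∧
          Integrable (fun u => Real.exp (δ * (M₁ (scaleNorm e lam (1 - st) u) : ℝ) ^ 2)) P₀)
      (f : (Fin m → X × HilbertScale zeta (α - s)) → Θ → U) (θ : Θ)
      (P : (Fin m → X × HilbertScale zeta (α - s)) → Θ → Measure U)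
      (_ : IsDataDependentPrior C₀ e lam st (fun S => f S θ) (fun S => P S θ)),
      BayesWellPosed β (scalePotential R φ zeta s T fun x u => L x (G u)) (fun S => P S θ)) ∧
    -- finite-dimensional data
    (∀ (N : ℕ) (Γ R : EuclideanSpace ℝ (Fin N) →L[ℝ] EuclideanSpace ℝ (Fin N))
      (_ : IsPosDefSqrt Γ R)
      (L : X → W → EuclideanSpace ℝ (Fin N)) (M₁ : ℝ≥0 → ℝ≥0) (M₂ : ℝ≥0 → ℝ≥0 → ℝ≥0)
      (_ : ForwardBounds e lam (1 - st) id (fun x u => L x (G u)) M₁ M₂)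
      (f : (Fin m → X × EuclideanSpace ℝ (Fin N)) → Θ → U) (θ : Θ)
      (P : (Fin m → X × EuclideanSpace ℝ (Fin N)) → Θ → Measure U)
      (_ : IsDataDependentPrior C₀ e lam st (fun S => f S θ) (fun S => P S θ)),
      BayesWellPosed β (finPotential R fun x u => L x (G u)) (fun S => P S θ) ∧
      BayesWellPosed β (misfitPotential R fun x u => L x (G u)) (fun S => P S θ)) := by
  obtain ⟨K, hK⟩ := hC₀.exists_bound
  have hr : 0 ≤ (1 - st) / 2 := by linarith
  have hd := inPowDomain_of_nonneg (e := e) hC₀.pos hK hr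
  have h0 : -(1 - st) / 2 + (1 - st) / 2 = 0 := by ring
  have hJ : ∀ w, InScale e lam (1 - st) (powOp e lam ((1 - st) / 2) w) := fun w => by
    rw [InScale, inPowDomain_powOp_iff hC₀.pos (hd w), h0]
    exact inPowDomain_zero w
  have hJn : ∀ w, scaleNorm e lam (1 - st) (powOp e lam ((1 - st) / 2) w) = ‖w‖₊ := fun w => by
    rw [scaleNorm, (hd w).powOp_powOp hC₀.pos (by rw [h0]; exact inPowDomain_zero w), h0,
      powOp_zero_exponent]
  have hJs : ∀ w w', scaleNorm e lam (1 - st)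
      (powOp e lam ((1 - st) / 2) w - powOp e lam ((1 - st) / 2) w') = ‖w - w'‖₊ := fun w w' => by
    rw [← (hd w).powOp_sub (hd w'), hJn]
  refine ⟨?_, ?_⟩
  · intro H _ _ _ _ κ C₁ φ zeta hC₁ s hs _ α Γ R hR T _ L M₁ M₂ hdomF hF hgrowth f θ P hP
    obtain ⟨K₁, hK₁⟩ := hC₁.exists_bound
    obtain ⟨V, hV⟩ := exists_powOp_eq_continuousLinearMap φ hC₁.pos hK₁ (r := s / 2)
      (by linarith [traceExponent_nonneg zeta])
    have hA : ∀ x x' u u', InScale e lam (1 - st) u → InScale e lam (1 - st) u' →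
        whiten R φ zeta s (L x (G u) - L x' (G u')) =
          whiten R φ zeta s (L x (G u)) - whiten R φ zeta s (L x' (G u')) :=
      fun x x' u u' hu hu' =>
        (hdomF x u hu).whiten_sub hR.injective_sqrt (hdomF x' u' hu')
    -- Only whitened forward values occur here, so the potential is a continuous function of T y and
    -- of a quantity covered by the forward bounds.
    have hΦ : ∀ u x y, InScale e lam (1 - st) u →
        scalePotential R φ zeta s T (fun x u => L x (G u)) u x y =
          (1 / 2) * ‖V (whiten R φ zeta s (L x (G u)))‖ ^ 2 -
            ⟪T y, whiten R φ zeta s (L x (G u))⟫ := fun u x y hu => by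
      rw [scalePotential, (hdomF x u hu).opInv_eq hC₁.pos, hV]
    refine hP.bayesWellPosed hC₀ hP₀ hst hst1 hβ (b := fun y => ‖T y‖)
      (N := fun u => M₁ (scaleNorm e lam (1 - st) u)) (fun x y => ?_) (fun u hu => ?_)
      T.continuous.norm (fun u => NNReal.coe_nonneg _)
      (hP₀.integrable_exp_mul_scaleNorm_comp hC₀ hst hF.mono₁ hgrowth) (fun u x y hu => ?_)
    · have hc := hF.continuous_scale hA hJ hJn hJs x
      simp_rw [hΦ _ x y (hJ _)]
      exact (((V.continuous.comp hc).norm.pow 2).const_mul _).sub (continuous_const.inner hc)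
    · have hc : Continuous fun z : X × HilbertScale zeta (α - s) =>
          whiten R φ zeta s (L z.1 (G u)) := (hF.continuous_space hA hu).comp continuous_fst
      simp_rw [hΦ u _ _ hu]
      exact (((V.continuous.comp hc).norm.pow 2).const_mul _).sub
        ((T.continuous.comp continuous_snd).inner hc)
    · rw [hΦ u x y hu]
      have h1 := real_inner_le_norm (T y) (whiten R φ zeta s (L x (G u)))
      have h2 : ‖whiten R φ zeta s (L x (G u))‖ ≤ M₁ (scaleNorm e lam (1 - st) u) :=
        hF.bound x u hu
      have h3 := mul_le_mul_of_nonneg_left h2 (norm_nonneg (T y))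
      have h4 := sq_nonneg ‖V (whiten R φ zeta s (L x (G u)))‖
      linarith
  · intro N Γ R hR L M₁ M₂ hF f θ P hP
    obtain ⟨V, hV⟩ := exists_opInv_eq_continuousLinearMap hR.injective_sqrt
    have hA : ∀ x x' u u', InScale e lam (1 - st) u → InScale e lam (1 - st) u' →
        id (L x (G u) - L x' (G u')) = id (L x (G u)) - id (L x' (G u')) :=
      fun _ _ _ _ _ _ => rfl
    have := hP₀.isGaussian
    -- The lower bounds below are uniform in u, so N = 1 serves and no exponential moment of M₁
    -- enters.
    have hN : ∀ c : ℝ, Integrable (fun _ : U => Real.exp (c * 1)) P₀ :=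
      fun c => integrable_const _
    have hcu := hF.continuous_scale hA hJ hJn hJs
    have hcx : ∀ u, InScale e lam (1 - st) u →
        Continuous fun z : X × EuclideanSpace ℝ (Fin N) => L z.1 (G u) :=
      fun u hu => (hF.continuous_space hA hu).comp continuous_fst
    constructor
    · refine hP.bayesWellPosed hC₀ hP₀ hst hst1 hβ (b := fun y => (1 / 2) * ‖V y‖ ^ 2)
        (N := fun _ => 1) (fun x y => ?_) (fun u hu => ?_)
        ((V.continuous.norm.pow 2).const_mul _) (fun _ => zero_le_one) hN (fun u x y _ => ?_)
      · simp only [finPotential, hV]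
        exact (((V.continuous.comp (hcu x)).norm.pow 2).const_mul _).sub
          (continuous_const.inner (V.continuous.comp (hcu x)))
      · simp only [finPotential, hV]
        exact (((V.continuous.comp (hcx u hu)).norm.pow 2).const_mul _).sub
          ((V.continuous.comp continuous_snd).inner (V.continuous.comp (hcx u hu)))
      · simp only [finPotential, hV]
        have h1 := real_inner_le_norm (V y) (V (L x (G u)))
        -- Completing the square: ½ ‖V F‖² - ‖V y‖ ‖V F‖ ≥ -½ ‖V y‖², where F is the forward value.
        have h2 := sq_nonneg (‖V y‖ - ‖V (L x (G u))‖)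
        linarith
    · refine hP.bayesWellPosed hC₀ hP₀ hst hst1 hβ (b := fun _ => 0)
        (N := fun _ => 1) (fun x y => ?_) (fun u hu => ?_)
        continuous_const (fun _ => zero_le_one) hN (fun u x y _ => ?_)
      · simp only [misfitPotential, hV]
        exact ((V.continuous.comp (continuous_const.sub (hcu x))).norm.pow 2).const_mul _
      · simp only [misfitPotential, hV]
        exact ((V.continuous.comp (continuous_snd.sub (hcx u hu))).norm.pow 2).const_mul _
      · simp only [misfitPotential]
        rw [zero_mul, neg_zero]
        positivity
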